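/- Let $W$ be the group with generators $s_0,s_1,s_2,s_3$ and defining relations $s_0^2=s_1^2=s_2^2=s_3^2=1$, $(s_0s_1)^5=(s_1s_2)^3=(s_2s_3)^5=1$, $s_0s_2=s_2s_0$, $s_1s_3=s_3s_1$, $s_0s_3=s_3s_0$ and $(s_1s_2s_3)^5=1$ (the group of the universal polytope of type $\{5,3,5\}$ with dodecahedral facets and hemi-icosahedral vertex figures). Put $\omega=(s_0s_1s_2)^5$ and $\nu=\omega s_3$, let $N'$ be the normal closure of $\nu^3$ in $W$ and $N''$ the normal closure of $\omega$ in $W$, and let $L=\langle s_2s_1,\ (s_0s_1)^2s_2s_3s_0,\ s_0s_1s_0s_3s_2s_3s_1\rangle\le W$. Let $J_1$ be the first Janko group, that is, the subgroup of $GL_7(\mathbb F_{11})$ generated by Janko's matrices $$Y=\begin{pmatrix}0&1&0&0&0&0&0\\0&0&1&0&0&0&0\\0&0&0&1&0&0&0\\0&0&0&0&1&0&0\\0&0&0&0&0&1&0\\0&0&0&0&0&0&1\\1&0&0&0&0&0&0\end{pmatrix},\qquad Z=\begin{pmatrix}-3&2&-1&-1&-3&-1&-3\\-2&1&1&3&1&3&3\\-1&-1&-3&-1&-3&-3&2\\-1&-3&-1&-3&-3&2&-1\\-3&-1&-3&-3&2&-1&-1\\1&3&3&-2&1&1&3\\3&3&-2&1&1&3&1\end{pmatrix},$$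 and let $L_2(19)=PSL_2(\mathbb F_{19})$. Theorem. The group $W$ is finite, of order $175560\cdot 3420$, and $W\cong J_1\times L_2(19)$. The subgroup $L$ has index $20$ in $W$ and order $30020760$. Moreover $W/N'\cong J_1$, $W/N''\cong L_2(19)$, and $W$ is the internal direct product of $N'$ and $N''$: the map $N'\times N''\to W$, $(a,b)\mapsto ab$, is an isomorphism of groups. -/

import Mathlib

open scoped MatrixGroups

namespace Polytope535

/-! ## The group of the universal polytope with dodecahedral facets and hemi-icosahedral
vertex figures -/

/-- Relators of the group `W`: those of the Coxeter group `[5,3,5]` and `(s₁s₂s₃)⁵`. -/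
def relators : Set (FreeGroup (Fin 4)) :=
  let s : Fin 4 → FreeGroup (Fin 4) := FreeGroup.of
  {s 0 ^ 2, s 1 ^ 2, s 2 ^ 2, s 3 ^ 2,
    (s 0 * s 1) ^ 5, (s 1 * s 2) ^ 3, (s 2 * s 3) ^ 5,
    s 0 * s 2 * (s 2 * s 0)⁻¹, s 1 * s 3 * (s 3 * s 1)⁻¹, s 0 * s 3 * (s 3 * s 0)⁻¹,
    (s 1 * s 2 * s 3) ^ 5}

/-- The group `W`. -/
abbrev W : Type := PresentedGroup relators

/-- The generators `s₀, s₁, s₂, s₃` of `W`. -/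
def s (i : Fin 4) : W := PresentedGroup.of i

/-- `ω = (s₀s₁s₂)⁵`. -/
def omega : W := (s 0 * s 1 * s 2) ^ 5

/-- `ν = ω s₃`. -/
def nu : W := omega * s 3

/-- `N'`, the normal closure of `ν³` in `W`. -/
def N' : Subgroup W := Subgroup.normalClosure {nu ^ 3}

/-- `N''`, the normal closure of `ω` in `W`. -/
def N'' : Subgroup W := Subgroup.normalClosure {omega}

instance : N'.Normal := Subgroup.normalClosure_normal

instance : N''.Normal := Subgroup.normalClosure_normal

/-- `L = ⟨s₂s₁, (s₀s₁)²s₂s₃s₀, s₀s₁s₀s₃s₂s₃s₁⟩`. -/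
def L : Subgroup W :=
  Subgroup.closure
    {s 2 * s 1,
      (s 0 * s 1) ^ 2 * s 2 * s 3 * s 0,
      s 0 * s 1 * s 0 * s 3 * s 2 * s 3 * s 1}

/-! ## The first Janko group

Janko's group is the subgroup of `GL₇(𝔽₁₁)` generated by the cyclic permutation
matrix `Y` (of order 7) and the matrix `Z` (of order 5) below. -/

/-- Janko's generator `Y`, with its inverse. -/
def jankoY : GL (Fin 7) (ZMod 11) where
  val := !![
     0, 1, 0, 0, 0, 0, 0;
     0, 0, 1, 0, 0, 0, 0;
     0, 0, 0, 1, 0, 0, 0;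
     0, 0, 0, 0, 1, 0, 0;
     0, 0, 0, 0, 0, 1, 0;
     0, 0, 0, 0, 0, 0, 1;
     1, 0, 0, 0, 0, 0, 0]
  inv := !![
     0, 0, 0, 0, 0, 0, 1;
     1, 0, 0, 0, 0, 0, 0;
     0, 1, 0, 0, 0, 0, 0;
     0, 0, 1, 0, 0, 0, 0;
     0, 0, 0, 1, 0, 0, 0;
     0, 0, 0, 0, 1, 0, 0;
     0, 0, 0, 0, 0, 1, 0]
  val_inv := by decide
  inv_val := by decide

/-- Janko's generator `Z`, with its inverse. -/
def jankoZ : GL (Fin 7) (ZMod 11) where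
  val := !![
     -3, 2, -1, -1, -3, -1, -3;
     -2, 1, 1, 3, 1, 3, 3;
     -1, -1, -3, -1, -3, -3, 2;
     -1, -3, -1, -3, -3, 2, -1;
     -3, -1, -3, -3, 2, -1, -1;
     1, 3, 3, -2, 1, 1, 3;
     3, 3, -2, 1, 1, 3, 1]
  inv := !![
     -3, -2, -1, -1, -3, 1, 3;
     2, 1, -1, -3, -1, 3, 3;
     -1, 1, -3, -1, -3, 3, -2;
     -1, 3, -1, -3, -3, -2, 1;
     -3, 1, -3, -3, 2, 1, 1;
     -1, 3, -3, 2, -1, 1, 3;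
     -3, 3, 2, -1, -1, 3, 1]
  val_inv := by decide
  inv_val := by decide

/-- The Janko group `J₁`. -/
def J1 : Subgroup (GL (Fin 7) (ZMod 11)) := Subgroup.closure {jankoY, jankoZ}

end Polytope535

/-! ## Certified coset enumeration

Letters are natural numbers: `2 * i` stands for the generator `i`, `2 * i + 1` for its inverse. -/

namespace CosetCert

noncomputable section

/-! The order of $W$ is squeezed between two bounds that agree.

From above: coset enumeration runs down a chain of subgroups with at most 20, 57, 266 and 132 cosets
in each other and ends in a cyclic group whose order divides 15; and 20·57·266·132·15 = 175560·3420.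
This is `finite_W`, resting on `finite_closure_subGens`. In hindsight the chain is $W >
J_1\times(19{:}9) > J_1\times 3 > L_2(11)\times 3 > C_{15}$.

From below: explicit matrices give a map onto $J_1$ that kills $\nu^3$ (`exists_hom_J1`) and a map
onto $L_2(19)$ that kills $\omega$ (`exists_hom_PSL`). Setting both $\nu^3$ and $\omega$ to 1 makes
$W$ collapse, so $N'N''=W$ (`sup_eq_top`). As $N'$ and $N''$ lie in the two kernels, the combined
map to $J_1\times L_2(19)$ is onto. The order of $J_1$ is a multiple of 175560, since it has
elements of orders 3, 5, 7, 11, 19 and an elementary abelian subgroup of order 8; that of $L_2(19)$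
is 3420. Hence the combined map is bijective, and the kernels are exactly $N'$ and $N''$.

For $L$: it contains the first subgroup of the chain, so $|W|\le 20|L|$, and it fixes a point in a
transitive action on 20 points, so its index is at least 20.

The enumerations are replayed from certificates. An edge from `a` to `b` by the letter `x` with
label `l` asserts that $r_a x r_b^{-1}$, with $r$ the coset representatives, is the value of `l` in
the generators of the subgroup. Every deduction preserves the truth of all edges (`Valid`), whatever
the certificate contains. A complete table covers the group by cosets (`Valid.cover`). A relator
traced around a closed path has a label that is trivial in the subgroup; such labels are the
relators for the next enumeration (modified Todd–Coxeter). Only upper bounds for indices and the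
validity of relators are used, never that the relators present the subgroup. -/

/-- The letter inverse to `x`. -/
def flip (x : ℕ) : ℕ := x + 1 - 2 * (x % 2)

/-- The formal inverse of a word. -/
def invWord (l : List ℕ) : List ℕ := (l.map flip).reverse

/-- Prepend a letter to a word, cancelling if possible. -/
def push (x : ℕ) : List ℕ → List ℕ
  | [] => [x]
  | y :: t => if Nat.beq y (flip x) then t else x :: y :: t

/-- A certificate for a coset enumeration. A coset table is stored in one natural number; an entry
records the target coset and a label. `defs` holds the parent and the letter that define each
coset, `steps` the deductions. -/
structure Cert where
  /-- number of generators -/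
  ng : ℕ
  /-- whether edges carry labels in the generators of the subgroup -/
  lab : Bool
  /-- relators -/
  rels : List (List ℕ)
  /-- edges that define the generators of the subgroup -/
  gens : List (ℕ × ℕ × ℕ)
  /-- number of cosets ever defined -/
  names : ℕ
  /-- bits per letter of a label -/
  lw : ℕ
  /-- bits per table entry -/
  wd : ℕ
  /-- parents of the cosets -/
  defs : ℕ
  /-- number of deductions -/
  len : ℕ
  /-- deductions -/
  steps : ℕ

variable (C : Cert)

/-- Number of letters, and the index of the trivial letter used for coincidences. -/
def Cert.nc : ℕ := 2 * C.ng

/-- Row length of the table. -/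
def Cert.row : ℕ := 2 * C.ng + 1

/-- Read a table entry. -/
def get (T k : ℕ) : ℕ := Nat.mod (Nat.shiftRight T (Nat.mul C.wd k)) (Nat.pow 2 C.wd)

/-- Write a table entry. -/
def put (T k e : ℕ) : ℕ := Nat.xor T (Nat.shiftLeft (Nat.xor (get C T k) e) (Nat.mul C.wd k))

/-- Decode a label. -/
def decAux : ℕ → ℕ → List ℕ
  | 0, _ => []
  | f + 1, n => match n with
    | 0 => []
    | m + 1 => ((m + 1) % 2 ^ C.lw - 1) :: decAux f ((m + 1) / 2 ^ C.lw)

/-- Decode a label. -/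
def dec (n : ℕ) : List ℕ := decAux C 64 n

/-- Encode a label. -/
def enc (l : List ℕ) : ℕ := l.foldr (fun x n => n * 2 ^ C.lw + (x + 1)) 0

/-- Multiply labels. -/
def mulLab (l l' : List ℕ) : List ℕ := match C.lab with
  | true => l.foldr push l'
  | false => []

/-- Invert a label. -/
def invLab (l : List ℕ) : List ℕ := match C.lab with
  | true => invWord l
  | false => []

/-- Label of the `j`-th subgroup generator. -/
def genLab (j : ℕ) : List ℕ := match C.lab with
  | true => [2 * j]
  | false => []

/-- Equality test for words. -/
def eqWord : List ℕ → List ℕ → Bool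
  | [], [] => true
  | x :: l, y :: m => Nat.beq x y && eqWord l m
  | _, _ => false

/-- Set the edge from `a` by the letter `x` to `b` with label `l`. -/
def setE (T a x b : ℕ) (l : List ℕ) : ℕ :=
  -- An entry is 1 + target + 1024 · label code, and 0 means unknown. An edge that does not fit, or
  -- whose label does not survive encoding, is dropped; so `dec` inverting `enc` is tested, not
  -- proved.
  match Nat.blt b 1024 && (Nat.blt x C.row && (Nat.blt (1 + b + 1024 * enc C l) (2 ^ C.wd) &&
      eqWord (dec C (enc C l)) l)) with
  | true => put C T (a * C.row + x) (1 + b + 1024 * enc C l)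
  | false => T

/-- Set an edge unless it is known. -/
def fill (T a x b : ℕ) (l : List ℕ) : ℕ := match get C T (a * C.row + x) with
  | 0 => setE C T a x b l
  | _ + 1 => T

/-- Follow coincidences. -/
def norm (T : ℕ) (f : ℕ) : ℕ → List ℕ → ℕ × List ℕ :=
  Nat.rec (fun b l => (b, l)) (fun _ ih b l =>
    Nat.rec (b, l) (fun e _ => ih (Nat.mod e 1024) (mulLab C l (dec C (e / 1024))))
      (get C T (Nat.add (Nat.mul b C.row) C.nc))) f

/-- One step in the coset table. -/
def step (T a x : ℕ) (l : List ℕ) : Option (ℕ × List ℕ) :=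
  Nat.rec none (fun e _ => some (norm C T 8 (Nat.mod e 1024) (mulLab C l (dec C (e / 1024)))))
    (get C T (Nat.add (Nat.mul a C.row) x))

/-- Trace a word. -/
def walk (T : ℕ) (a : ℕ) (l : List ℕ) (w : List ℕ) : Option (ℕ × List ℕ) :=
  List.rec (fun a l => some (a, l)) (fun x _ ih a l =>
    Option.rec none (fun p => Prod.rec (fun b m => ih b m) p) (step C T a x l)) w a l

/-- Copy the edges of `a` to `b`. -/
def copyEdges (a b : ℕ) (l : List ℕ) : ℕ → ℕ → ℕ
  | 0, T => T
  | y + 1, T => copyEdges a b l y (match get C T (a * C.row + y) with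
    | 0 => T
    | e + 1 => fill C T b y (e % 1024) (mulLab C l (dec C (e / 1024))))

/-- Record that the representative of `a` is `l` times that of `b`. -/
def merge (T a b : ℕ) (l : List ℕ) : ℕ := match Nat.blt a b with
  -- The coset with the smaller number survives and inherits the edges of the other.
  | true => copyEdges C b a l C.nc (setE C T b C.nc a (invLab C l))
  | false => copyEdges C a b (invLab C l) C.nc (setE C T a C.nc b l)

/-- The `i`-th relator, inverted if `f = 1`, rotated by `k`. -/
def relWord (i f k : ℕ) : List ℕ :=
  let w := C.rels.getD i []
  let u := match f with
    | 0 => w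
    | _ + 1 => invWord w
  u.drop k ++ u.take k

/-- Parent of the coset `k` (times 32) plus the letter leading to `k`. -/
def Cert.par (k : ℕ) : ℕ := (C.defs >>> (16 * k)) % 65536

/-- Define a coset. -/
def opDef (T k : ℕ) : ℕ := match Nat.blt (C.par k / 32) k with
  | true => fill C (setE C T (C.par k / 32) (C.par k % 32) k []) k (flip (C.par k % 32))
      (C.par k / 32) []
  | false => T

/-- Deduce an edge from a relator. -/
def opEdge (T a : ℕ) : List ℕ → ℕ
  | [] => T
  | x :: v => match walk C T a [] (invWord v) with
    | none => T
    | some (b, l) => fill C (setE C T a x b l) b (flip x) a (invLab C l)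

/-- Deduce a coincidence from a relator. -/
def opCoin (T a : ℕ) (u : List ℕ) : ℕ := match walk C T a [] u with
  | none => T
  | some (b, l) => merge C T a b l

/-- Deduce a coincidence from the two edges by the letter `y` at identified cosets. -/
def opCong (T c y : ℕ) : ℕ := match Nat.blt y C.row with
  | false => T
  | true => match get C T (c * C.row + y) with
    | 0 => T
    | e + 1 => match norm C T 8 (e % 1024) (dec C (e / 1024)), norm C T 8 c [] with
      | (a, l), (c', m) => match step C T c' y m with
        | none => T
        | some (b, l') => merge C T a b (mulLab C (invLab C l) l')

/-- Perform the deduction with the given code. -/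
def doOp (T n : ℕ) : ℕ := match n % 4 with
  -- Layout of the 24 bits: 2 for the kind, 10 for the coset, 5 for the relator, 1 for inversion, 6
  -- for the rotation. For a congruence the last field is the letter.
  | 0 => opDef C T (n / 4 % 1024)
  | 1 => opEdge C T (n / 4 % 1024) (relWord C (n / 4096 % 32) (n / 131072 % 2) (n / 262144))
  | 2 => opCoin C T (n / 4 % 1024) (relWord C (n / 4096 % 32) (n / 131072 % 2) (n / 262144))
  | _ => opCong C T (n / 4 % 1024) (n / 262144)

/-- Perform all deductions. -/
def run : ℕ → ℕ → ℕ → ℕ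
  | 0, _, T => T
  -- The match forces the table to be evaluated to a numeral before the next deduction; the empty
  -- table 0 signals failure.
  | n + 1, i, T => match doOp C T ((C.steps >>> (24 * i)) % 16777216) with
    | 0 => 0
    | t + 1 => run n (i + 1) (t + 1)

/-- The table that contains the edges for the subgroup generators only. -/
def initT : ℕ → List (ℕ × ℕ × ℕ) → ℕ → ℕ
  | _, [], T => T
  | j, (c, x, d) :: t, T => initT (j + 1) t
      (fill C (setE C T c x d (genLab C j)) d (flip x) c (invLab C (genLab C j)))

/-- The final table. -/
def final : ℕ := run C C.len 0 (initT C 0 C.gens 0)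

/-- Cosets not identified with another one. -/
def isLive (T a : ℕ) : Bool := Nat.blt a C.names && Nat.beq (get C T (a * C.row + C.nc)) 0

/-- All letters `< n` lead from `a` to live cosets. -/
def closedAt (T a : ℕ) : ℕ → Bool
  | 0 => true
  | x + 1 => (match step C T a x [] with
    | none => false
    | some (b, _) => isLive C T b) && closedAt T a x

/-- The list of live cosets below `n`. -/
def live (T : ℕ) : ℕ → List ℕ
  | 0 => []
  | a + 1 => match isLive C T a with
    | true => a :: live T a
    | false => live T a

/-- The table is complete on live cosets. -/
def closedAll (T : ℕ) : List ℕ → Bool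
  | [] => true
  | a :: t => closedAt C T a C.nc && closedAll T t

/-- The table is complete, with `m` cosets. -/
def isComplete (m T : ℕ) : Bool :=
  isLive C T 0 && (closedAll C T (live C T C.names) && Nat.beq (live C T C.names).length m)

/-- All letters of the word are letters of the certificate. -/
def lettersOK : List ℕ → Bool
  | [] => true
  | x :: l => Nat.blt x C.nc && lettersOK l

/-- All letters of the relators are letters of the certificate. -/
def relsOK : List (List ℕ) → Bool
  | [] => true
  | w :: t => lettersOK C w && relsOK t

/-- Check that the words of the queries trace closed paths with the given labels. -/
def queriesOK (T : ℕ) : List (ℕ × List ℕ × List ℕ) → Bool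
  | [] => true
  | (c, w, l) :: t => (match walk C T c [] w with
    | none => false
    | some (b, m) => lettersOK C w && (Nat.beq b c && eqWord m l)) && queriesOK T t

/-- Check of a certificate: the queries hold and, if `m ≠ 0`, the table is complete with `m`
cosets. -/
def check (Q : List (ℕ × List ℕ × List ℕ)) (m : ℕ) : Bool := match final C with
  | 0 => false
  | t + 1 => relsOK C C.rels && queriesOK C (t + 1) Q && (Nat.beq m 0 || isComplete C m (t + 1))

end

/-! ### Certificates for the chain of subgroups -/

/-- Relators of `L`, in the generators found by `certL`. -/
def relsL : List (List ℕ) :=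
  [[2, 0, 3, 3, 1, 3, 1, 1, 3, 0],
    [2, 0, 3, 3, 1, 3, 0, 3, 0],
    [1, 1, 1]]

/-- Relators of the subgroup of `L` of index 57. -/
def relsJ : List (List ℕ) :=
  [[2, 1, 2],
    [6, 14, 10, 6, 15],
    [7, 4, 1, 2, 7, 4, 1, 2],
    [8, 14, 9, 9, 14],
    [11, 1, 11, 1],
    [7, 7, 4, 1, 7, 13, 14, 13, 3, 0, 10, 0, 0, 15, 9],
    [13, 3, 0, 10, 0, 0, 15, 0, 5, 1, 7],
    [15, 3, 15, 12, 4, 1, 2],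
    [13, 7, 13, 7],
    [1, 11, 1, 2, 12, 15, 12, 4, 4, 15, 7, 14, 1],
    [11, 15, 9, 6, 9, 6, 14],
    [13, 14, 3, 0, 5, 1, 7, 8, 14, 10, 6],
    [10, 7, 7, 11, 8],
    [6, 14, 5, 1, 2, 6, 0, 6, 6, 0, 5, 6, 6],
    [8, 0, 5, 6, 13, 14, 3, 0, 4, 15, 7],
    [0, 11, 5, 6, 6, 6, 0, 6, 6, 0, 10],
    [11, 1, 2, 7, 13, 14, 13, 3, 0, 5, 6, 6, 6, 14],
    [10, 4, 10, 4],
    [3, 0, 5, 6, 13, 3, 0, 10, 10, 6, 13],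
    [3, 7, 7, 1, 7, 8, 14, 10, 7, 13, 14, 13],
    [2, 14, 3, 0, 4, 15, 0, 4, 1],
    [3, 0, 5, 13, 14, 13, 3, 13, 14],
    [7, 11, 11, 9, 7],
    [14, 1, 2, 14, 3],
    [0, 15, 0, 6, 6, 2, 7, 13, 14, 13, 3, 0, 10, 0],
    [8, 14, 8, 14],
    [4, 4, 4],
    [0, 0, 0],
    [9, 9, 9]]

/-- A consequence of `relsJ`. -/
def extraRel : List ℕ := [15, 7, 7, 8, 6, 6, 9, 7, 8]

/-- Another consequence of `relsJ`. -/
def extraRel2 : List ℕ := [9, 7, 9, 7, 9, 7]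

/-- Closed paths that yield `relsL`, and paths for two of the generators of `L`. -/
def pathsL : List (ℕ × List ℕ) :=
  [(0, [0, 2, 0, 2, 0, 2, 0, 2, 0, 2]),
    (3, [0, 2, 0, 2, 0, 2, 0, 2, 0, 2]),
    (0, [2, 4, 2, 4, 2, 4]),
    (0, [0, 2, 0, 2, 4, 6, 0]),
    (0, [0, 2, 0, 6, 4, 6, 2])]

/-- Labels of `pathsL`. -/
def labelsL : List (List ℕ) := relsL ++ [[2, 0, 3, 3],
    [2, 0, 3, 0]]

/-- Closed paths that yield `relsJ`. -/
def pathsJ : List (ℕ × List ℕ) :=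
  [(0, [2, 0, 3, 3, 1, 3, 1, 1, 3, 0]),
    (6, [2, 0, 3, 3, 1, 3, 1, 1, 3, 0]),
    (9, [0, 2, 0, 3, 3, 1, 3, 1, 1, 3]),
    (3, [0, 3, 3, 1, 3, 1, 1, 3, 0, 2]),
    (14, [0, 2, 0, 3, 3, 1, 3, 1, 1, 3]),
    (18, [2, 0, 3, 3, 1, 3, 1, 1, 3, 0]),
    (9, [0, 3, 3, 1, 3, 1, 1, 3, 0, 2]),
    (23, [2, 0, 3, 3, 1, 3, 1, 1, 3, 0]),
    (25, [1, 3, 1, 1, 3, 0, 2, 0, 3, 3]),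
    (27, [2, 0, 3, 3, 1, 3, 1, 1, 3, 0]),
    (20, [1, 3, 0, 2, 0, 3, 3, 1, 3, 1]),
    (16, [0, 3, 3, 1, 3, 1, 1, 3, 0, 2]),
    (35, [2, 0, 3, 3, 1, 3, 1, 1, 3, 0]),
    (18, [0, 2, 0, 3, 3, 1, 3, 1, 1, 3]),
    (36, [0, 2, 0, 3, 3, 1, 3, 1, 1, 3]),
    (39, [0, 3, 3, 1, 3, 1, 1, 3, 0, 2]),
    (40, [0, 2, 0, 3, 3, 1, 3, 1, 1, 3]),
    (20, [0, 3, 3, 1, 3, 1, 1, 3, 0, 2]),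
    (43, [0, 2, 0, 3, 3, 1, 3, 1, 1, 3]),
    (45, [2, 0, 3, 3, 1, 3, 1, 1, 3, 0]),
    (12, [3, 1, 3, 1, 1, 3, 0, 2, 0, 3]),
    (48, [0, 2, 0, 3, 3, 1, 3, 1, 1, 3]),
    (25, [0, 2, 0, 3, 3, 1, 3, 1, 1, 3]),
    (26, [0, 2, 0, 3, 3, 1, 3, 1, 1, 3]),
    (27, [0, 2, 0, 3, 3, 1, 3, 1, 1, 3]),
    (3, [0, 3, 3, 1, 3, 0, 3, 0, 2]),
    (20, [3, 0, 3, 0, 2, 0, 3, 3, 1]),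
    (13, [1, 3, 0, 3, 0, 2, 0, 3, 3]),
    (35, [1, 1, 1])]

/-- Attach labels to paths. -/
def mkQueries (P : List (ℕ × List ℕ)) (L : List (List ℕ)) : List (ℕ × List ℕ × List ℕ) :=
  List.zipWith (fun p w => (p.1, p.2, w)) P L

/-- Certificate for the cosets of `L` in `W`. -/
def certL : Cert where
  ng := 4
  lab := true
  rels := [[0, 0],
    [2, 2],
    [4, 4],
    [6, 6],
    [0, 2, 0, 2, 0, 2, 0, 2, 0, 2],
    [2, 4, 2, 4, 2, 4],
    [4, 6, 4, 6, 4, 6, 4, 6, 4, 6],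
    [0, 4, 0, 4],
    [2, 6, 2, 6],
    [0, 6, 0, 6],
    [2, 4, 6, 2, 4, 6, 2, 4, 6, 2, 4, 6, 2, 4, 6]]
  gens := [(1, 2, 0), (15, 6, 19)]
  names := 20
  lw := 3
  wd := 26
  defs := 0x16201270107010200e400c700c100c400a400870082006400470042002700210007000100040000
  len := 78
  steps := 0x4003108704900203504504900002508704100103508803d0030350c902d04003900702d04202900603904202504504504304104803104103100a04504004508904d00304d00204d0c504104101508800d04100104003d00702100002908901504101d08803900104908802900201104700904000d08901d04203d04102500301100200500203100101904104100300500301904300100104d04202d04000500300900302104000100202104001904302500004c00004800004400004000003c00003800003400003000002c00002800002400002000001c00001800001400001000000c000008000004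

/-- Besides the 20 cosets, the queries record three relators of the subgroup and the second and
third generators of `L` as words in its two generators. -/
theorem certL_check : check certL (mkQueries pathsL labelsL) 20 = true := by decide +kernel

/-- Certificate for a subgroup of index 57 of `L`. -/
def certJ : Cert where
  ng := 2
  lab := true
  rels := relsL
  gens := [(39, 0, 39), (4, 0, 8), (42, 0, 42), (31, 0, 33), (35, 0, 35), (35, 2, 56), (43, 2, 52), (17, 0, 11)]
  names := 57
  lw := 5
  wd := 36
  defs := 0x3e103600341034003210320030102e102e002c102c002a202a102a00283028102800263024202410240022202230203020101e201e301c201c301a201820142014301220123010200e300e000c200c000a300a100a000820081006300610060004200430022002300020003000100000000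
  len := 106
  steps := 0x800610800c50c10bd0c109d0820750410b50c10d91410591410dd0010a11c10b90010c90820c92010610010c10820891810890010650810310020191410c90810ad1c10a100104d1410cd0c10711410d50420812010410020e11410a90810c104107504203100201d04104d1410a50010b90c10891410810820290420090020d90820a50020bd0820c500209504203d0820b10420d10000e00000dc0000d80000d40000d00000cc0000c80000c40000c00000bc0000b80000b40000b00000ac0000a80000a40000a000009c00009800009400009000008c00008800008400008000007c00007800007400007000006c00006800006400006000005c00005800005400005000004c00004800004400004000003c00003800003400003000002c00002800002400002000001c00001800001400001000000c000008000004

theorem certJ_check : check certJ (mkQueries pathsJ relsJ) 57 = true := by decide +kernel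

/-- Certificate for a further relation in that subgroup. -/
def certRel : Cert where
  ng := 8
  lab := true
  rels := relsJ
  gens := [(0, 14, 0)]
  names := 179
  lw := 2
  wd := 17
  defs := 0x11ef160d00c5126f15a10eae0e210fa613cc040d07e60eab12c70aad0eea144d12a7140f00c3120609860a47036a0a860c460266066c03870a2e00ce126a00c40f6b036b020600c203a702070b4700ca08cc04a7064700a80c6402e1072d0f4a03cc0c870fe708620faf080000cb0381040906cf0eef0405038900c105630e2a0e2b04040de104c703000bab0d62080a0d2b0801000a01ce0caa080801ae01ec006b0c0701610907040b002e0b6203ad040a0b0005a601c907880467036608ae038a0186094e09cf03e3098d058408880028090602e30827018303e1080b0440062e080702a507c6044301e20067042e048b064006e306cb0180068a01810302002f030d05ef024800210146002b014b018a050e02cd04cd012a048f02a40441004400230060002503a201e702aa02a9020f01e1004b02ca0024002201e302490006020501e0000801a60182000901450000000100e800c700a9008600660048002700070000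
  len := 314
  steps := 0x2000331c01473c025b18029b0f329a0a00e915028d1470e90372c90002c81d51ad2292b91272c50002c403a2c10002c01212bd0002bc0a02b50972b90002b80002b40761051c02af0ef2ae0242a202f2b10c12362891e11672610a01c513526122b2b10002b00002ac0282a90002a80002a418f2a10ec2a10002a01ef20d04429d00029c00029801919d1c027f27827e18529500029405129100029000028c00028800028402028106028100028000027c0a016500d22604217d23827900027808c27500027400c1d903c2450760710ac27100027000026c0ec26900026800615d18b1c10170a511222a04220504017116720913520926b13d10a26504126500026400026000025c00a25900025800025405125100025000024c04424900024800024400024000023c05623900023800023408c23100023000022c00022800022400022003c21d0b621d00021c00019114721900021822e04616718503512108021500021400021000020c0002080a12050002040002000400f90001fd0001fc0001f801b1f50001f40001f00001ec0001e80371e50001e40001e003a1dd0001dc0001d80001d41e91350061850201d10001d00511cd0001cc0001c80001c40001c00001bc0641b90a01b90001b804a1b50001b40001b10001b00511ad0241ad0001ac0001a80001a40ec1750c11a10001a000019c01c19902c1110f619900019800019400019002818d00018c04418900018800018400018000017c00017800017400017000016c00016800016400016000015c00015800015400015000013d05714d13414d00014c00014800014401914100014004713d00013c02013900013800013401a1310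0013000c12d00012c00012800012400012000011c01711902011906011900011800011403111100011001b10d00010c00010800010403a1010e21010001000000fc0200f90000f80000f50400f50000f40000f00a00e51170ed0000ec0000e80000e40200e10000e00440dd0000dc01b0d90a00d90000d80000d40000d00000cc0000c80000c403907508a0c10000c003c0bd0b60bd0000bc0800b90000b80000b40310b10e10b10000b00440ad0000ac0000a80000a40000a000009c00009800009400009000008c00008806008500008400008003a07d00007c00007800007400007000006c00006803b06508006500006409606100006000005c00005800005400005000004c00004800004400004003c03d05903d00003c00003800003400003000002c01b02900002800002400002000001c00001800001400001000000c000008000004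

/-- The final 0 waives completeness: only one closed path at the coset 0 matters. Its representative
is 1 and the label is empty, so the word itself is trivial. -/
theorem certRel_check : check certRel ([(0, extraRel, [])]) 0 = true := by decide +kernel

/-- Certificate for another relation. -/
def certRel2 : Cert where
  ng := 8
  lab := true
  rels := relsJ ++ [extraRel]
  gens := [(0, 6, 0)]
  names := 200
  lw := 2
  wd := 17
  defs := 0xf4016000dca120b10cd0b210c0c10c712cc0763178517600088096a156b02e5020316a30e850320086c052f1601008e10a00380060f05af04400b0f02e40e4f026e11ed148b02c114410e4a006305cf086e05ca0e43136d0e41090a0ace10a70501004f028e0b000b0102ef0def00610e840f81080b09680f470a670b0a10e2100d0a470de7106d104603051002006a018e0cc6000a02ca0f4b072702230ee60de601ac0e81006e02e10de4002a0221006000e90d8a020205c90c4a004705cb01060cad0707002b0c4506620187002f05c105030b8a03c00b4f0b2302440a48096900ed090802a40a4c01ef054009eb002102470100096e094d0347090907ac034f01ee088701ec0042070e0526034c04c8072b02420762004d0724070c0022046a06ac01230663000d056a0121006205c800e5004002860048052700ea04e4000c04ac00e603cb0441042e000103ea00e80245026200ef034e0002030f002002c8002402800026024d000e00e4002d000301a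0000f01610005012e0008000b000000a7008900670049002700090000
  len := 350
  steps := 0x1952713800271c00172402ef2002ef0402f31002f722e2f60d61c91522760641ee28f31d00031c01b31900031804c29506c1ad1cf2950ac0810ec2390d60e914f1f907105d1c92a60641450012c900c05d0cf1f10ac3150003140002050d61a100c0bd00417d0c121628928104431100031000c15506c12528012300025310625210b15204016d0372a900024f19224e00030d0c217504830d00030c04716d0803090003080241b51d50e61073050003040563010003000002fc00e1850920f10602f90002f80002f40002f003c2ed0002ec0002e80442e50002e403a2e10002e00602dd0002dc08726d0542750202d90002d803a2d50b42d50002d40a02d10002d00002cc0002c80002c40002c00002bc0210992c01030b50d20a72b90a02b90002b80372b50b72b50002b40372b10002b001b2ad0002ac0002a80002a40002a000029c00029803b23904429500029400029000028c00028802028506028500028400028000027c00027802027500027400027000026c00026803b1a90040d11a62650171c10402211552651672650002640002600400750b51210070d902217a08025d00025c00025826b1e504c20100a25506125500025401b25100025000024c00024800024403b24100024000023c00023800023403c23100023000022c00022800022400022000021c00021800021400021000020c0002080002040002001341fd0001fc0001f802c1910f61f50001f40511f10001f00001ec0001e80201e50001e40001e00001dc0001d80001d40031d10001d00001cc0001c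804c1c50241c50001c40001c00a01bd0001bc01c1b90001b80001b40001b001c1ad0001ac0001a80001a40311a10001a000019c0481990001980001940001900d218d00018c04018900018800018412318100018000017c00017802417500017400017000016c00016801a16500016400016000015c04815900015803c15500015400015010714d00014c0a00890b714900014800014400014003b13d00013c0310910a113900013801b13506413500013400013004812d00012c0001280001240001200400f503711d00011c0a003911711900011800011400011000010d00010c1171090001080ec1050001040001000000fc0000f80000f40000f00000ec0000e80000e40000e10000e00000dc0000d80200d50000d40000d00480cd0000cc0000c80000c40000c00000bc03a0b90000b80000b423d0b10000b003c0ad0000ac0000a80240a50000a40000a000009c00009800009400009000008c00008803b08508008500008400008000007c00007800007403707100007000006c00006904006900006800006400006000005c00005800005400005000004c00004800004400004000003c00003812303500003400003000002c00002803c0250b602500002410c02100002000001c00001800001400001000000c000008000004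

/-- As for `certRel_check`, with `extraRel` now available as a relator. -/
theorem certRel2_check : check certRel2 ([(0, extraRel2, [])]) 0 = true := by decide +kernel

/-- Certificate for a subgroup of index 266. -/
def certH : Cert where
  ng := 8
  lab := false
  rels := relsJ ++ [extraRel, extraRel2]
  gens := [(0, 6, 0), (0, 8, 0), (0, 10, 0), (0, 14, 0)]
  names := 413
  lw := 1
  wd := 11
  defs := 0x14c3100e0d400ce20ca70c8b0aeb0acd0aa30a640a0709cb09430908090a08ad086d086c086907c007a007a607650745074c06e306cf06c606cd068f0666066b066d06210600060c05c205ce05c805cb05c00568056a0569054c05440529052e0508050c050a050f050904ca04a504a3048a04850462046e0464046f046d044d04430423042104250427042c0424042004000407040604090404040b040803e503e403c403cc03c503c703a303ac03a203800384038a038b03880386038e03890385038d038f0347034603400348034a034b03490345034c032b03220324032d03200323030a030c0309030e0305030b03030301030003040308030202e802eb02ee02e302e902e502e402ec02e602ed02e102e002ea02e202c802ca02ce02cf02c102c302cd02c202cc02c602c902a502a102ac02a702a402ae02a9028b0281028d02830285028c0287028a0284028f02630262026f0264026802690266026b02600261026a0265026d0246024402400242024f0247024c024e0243024d024b0227022e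0223022502210222022d0226022c02240220020a020b0208020d020602050209020102070202020e020c0200020401e401e001ed01e901e101ec01e501ea01e201e301ef01ee01c501c001cf01c301cc01cd01c601c701c201ce01c101cb01c401a701a801a301a101a901af01a201a601ae01ac01a0018c018e01850188018a018b0189018401860187018f018d016a0169016b0160016301610167016f016e01620165016c0164016801480140014a014701420144014f014c014301460149014b0141014e0145012b012001220121012c0123012d0127012a0129012e01280126010d010b0107010e01000102010c01030101010f01060108010900ef00e800ee00ea00e100e000e900e500e600eb00e200ed00e400c900c400cc00c800cb00c700cf00c500ca00c600a500ac00a700a800af00aa00a600ae00a400ad00a9008e008f008700850080008b00820084008100830088008a008c00890067006200680060006c006900630061006a0066006e006f006d004800490045004d004a004e004b004700460044004c002f002d002b0029002e00260028002500220027002c00240004000d00030001000c0005000200000000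
  len := 2305
  steps := 0x846132567101665912c6710834311b36712786710176711d56710876712c54ed02067106067100067003766d1c666d26566d10156d0e266d08d66d00a66d02766d0a566d1c566d00366d08366d06166d08166d00066c0766692f366900b66910a6692656690416690ec5e504f6691cd6690a66693456693056690646690a26690a066900066802466522f57900c66507e5e92654410a24fd08149114d6651a76650076651e56650026650006650406650006640806610b366126e39908f6611255d117d66122d6611ad66106d6610aa6611456610426610216610a16610006600e729901765d02065d19559d0e765d0313e50ec3650446510f265d08f65d02c65d10c65d04465d0e165d00065c1e56590801650806591a96590315b904425d0615c10f265908f65902c65910c6590446590e165900065812956928f65528d6550135e512f65500c1f12ab6390aa3c50c53050055b13853110486552056551856550006541c94710516510f664d06365100a26902526914557512126d00126d0176511d565108765102065106065100065004764d26564d15430500e64d2a555d02056902c26902464d01126d0c72990021f501a64d2ed64d08264d00064c1c54050715fd08d6492666492e564906526117d64925364922f64922d6491ad6490aa6490456490216490a16490006481455850176450206451955a50e76450315fd0ec5a90445d50613210f264508f64510c6450446450e164500064401a6411584ed05139502416d00c6410bd3ed00c3590086290051f93855a92786410176411d56410876410206410606410006401e563d04063d0806210b563d04861a0b34fd08e2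850814b903e63d01d63d04e63d00c63d0ea63d0a363d00063c0755490376390e363508336502c6390042390425fd0001d52af63904c6390246390c16390006380b563520963505156d0242c506c6350d61c100c5fd2ab5dd0aa4610c55d900515504863520563518563500063404457508f63112c1fd17d6310aa6311456310426310a16311ed5fd1a75150603450a01210126310486311276310006300c762d08f62d04462d0cc22907662d08f5d908f56d10a62d1185d11374c50405a90804b90b562d02662d22562d00062c01353517062922f1e50ad6290cc1e514b10d1aa10d0083950c23c51dd6290ca6290236291036290c36290006280131392ab1490083053851910e13f519862504f6251cd6250a66251866253056250646250a26250a062500062400b62110a6210686210256210416210ec37d04f6211ab6213456213056210646210a26210a062100062008e61d06054d2920f502061d07661d01211528f30d18d61d28d2a512c4f900b61d10a61d3a561d10161d04161d00061c00361908161918a56907161914b6191696190e76190006180b54750686150e329902c61510c61505638d2f32990ec16518a4790445b907161514b6151696150e76153656150006140584ad0246111aa15d2091891461650a311512352d0a11611356110b561102b61102861110761100061004260d0d639904c1ed00c1d50aa13900815127860d01760d1d560d08760d02060d06060d00060c0646090a26092333593705c51076092256090751d90376090c76090476091c66091236090636091216090016090006080481220336050001a903a56103160504460509614119d60511260524d6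0520d60512c6050256051016050006040006000085fd16d2510a55fd1274610403b90375fd0475fd2655fd1235fd0635fd0005fc26f50d2065050045cd0424e10f547503323902c5f110c5f101058d1264252061e90425910000fd03b5f10045f10805f12461790285f51e55f90405f90805052f35f90ec5f916b5f900b5f90255f90415f90005f80005f51a512d0685f50255f50415f50ec5890441f90715f503a26908f5f502c5f504a5f50445f50005f40005f01ae0d922d5ed0ad0c90065ed0425ed13d0d112c1c104a5a90832910430d92ae5ed12d5ed1a65ed0805ed0005ec0c71550685e90415e90261910645e10202fd01b5e91375e91cf5e91ab5e92065e90645e90a05e90005e805111d06c5e50e71d50c34c900354d3385e51a65e50405610b55e52305e502b5e50005e40685e10245e103c2250252011f22fd1075e103c5e121d56903326d1aa1ed2095210c11e90775e11a75e10005e10405e10005e00a95dd0e75dd03a4b50831550031550545dd01b5dd0a75dd0602150a021508b5dd00a5dd0035dd0815dd0005dc0325d91075d90c326117d1d52381f112f2c51ae22900c5290c255d0fd5d911d5d903c5d900c5d90e35d90435d90005d80e73590175d50205d51950d528b3210e75d50315150444a10965d50315d502c5d50e15d50005d406855d0c75d11235d10635d115458d1f34b502028501b5d11865d10005d01c90c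10245790285790331a12ad4fd1aa3f10a344d12337d0a14c526b5790005790b55cd1075cd1ae5890083f50213190fd5cd04e5cd00c5cd0a35cd0005cc1893cd1ae0dd08a5c91142a50773992b03b10061fd0a02750a25c90a05c90244fd2125c90515c90305c90245c90c15c90005c80ce3720805c50663cd0751611075c51ae0b50084112462190c23b11dd5c50ca5c50235c50005c41121890205c101216d10c4310115c101a30526d1290515c10245c108143106843107516d0265c12255c10005c00c74f90b554d0685bd0665bd0ac5ad14a5bd02c5690115bd2ed5bd2095bd0825bd0005bc0605b92383990ad5b900c2b90082891165b906c5b90ca5b90235b91035b90c35b90005b800814d15425d1691f903155d0081fa0c75a91215a91375890801b90315911a55a904458d0961e901c58d2384b90d60d10085210c258508c58d02158d0d044d1a958d03c30510327903130512c55d02555d14d26901b55d06455d0aa5b516d12916b1a510755d1175b50575b51905b500a5b50615b50815b50005b40e755512c30508327901e1f505d25508a2552ae30522b3050c55b10793b10633b138511500832d0e745503756120e5151095ad10c5a902a3b111635a2125a903e5b101d5b103c5b10b65b10435b10005b037016104219d0405ad08014d0b55ad2255ad0005ac1c90b91895050515a90005a80395a502c42d0f55210c752d1ab5a50645a5189535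01b52100e5950640d92ab5a51c65a50015a50005a40005a002a3c51035352cd25a07125d01a40d0022690204590a00b92384610684610f514d10725d1ae26901a1f10542690ad4ad12154d07636507645506c5751f82a11894590c754116a59d02c1e510c59132559d0f659d05159d2af59d04c59d02a59d02459d0c159d00059c26f1551450c12921650482610063c51375810a045626611504459904f57103a5990d259900059810c42d0040ad2855950a25950600ad09642e19d1110485551550a500b1a10e74891212a10175951d55951124c90205950605950005941541150244590005910f71551955910081090212850ea59104359110c1e50f65910c159100059003a58d00058c0222020002011382252d31411953a606815104b13a1d52611cb5751265810f656d1cf1ed03e46110c39925226101139903a26d0512760a71010b74c90753952145521874c910122501e2160e34b222f0990b62090251d50b512902c46106818d0313b512c4b507656d02422501122520958902c54d0cc4250f44c918b4c90444c90f64c905112906c58901940d0c319504446100440d00e5320195350835350bd5710685450c154501a5451140b50a35490034910ea0da1b315d03119114d0d103a32d0314cd0a74490775450802f508054512f47900c46d0363f110e3f107944d01e46d1234911864b90e231903b0e923254d0e616d0252910003f10b33c530940d1233c502118d15451110f22902618d06453500f3c514f2910713590c62551d51950483051122790a23ed11714d0c125520026700e2660e925d0e235903a1f52061110c13950692390e6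3c502150d28e1e91c550d00350d19057d0a02010a050d01732111427908250d1675350742792d31390e70fd0a12512c94dd06e3ed03a18d07118d0a74750a04751172a50f43991144250405191a75890005890405890005882304c20084710081051054b903b1b926e4b90234c111426901b19d1340c918d2f514b58503a46d06150500a5851295850035850835850615850815850005840075750a054d18d37110711104035914d2510002510c71750683a207542d0c712d00654120e54910b5490645490a05810a04fd11754912637d01b3750245810113950c91110c725506654901a58101158100058003737509657d0e157d0515750245750811410e71491371dd2341dd1941dd11251a09651910a51507120e06c1dd0c31dd0d63210081a90e13111af1dd14d57500057503b5411344311e534500413104057d0b534506857d2a61e51c657d12357d06357d12157d00157d00057c0005781955750005740e132d04c2a50e114d0e72290611e523011100251122f10d0414110c13c50115710813a50191610c34dd10c32120f5150284912b05111894891863a506411101142504220907150d1f21211cb1951552550a72912ab1f51372550e721a0234b50d653110c3cd0eb1610a12ea0081d90e72111d51e90684491b24710004710310b90a11550540a10000a100031102231101b1e91035050c350507745516a2f50b64fd0dd0a52f337118f38d02c4710810f91013710364fd2924fd05150502a5050245050c150526f2112502110ac21104c2110a91fd0651fe0641e51aa4e10084f90ea0f50804eb3c04f72804f72004f71014f6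0814f50e316d10315102c4f910c4f90044cd0574f91174f91a75110032110832110240a12125110641f501132114e0f51c90e50a65113183191350b60e746d0e246d13457104b1f10602910711150175710a72a102057106057100057006419529256908e3f10365692b33991ab1d506856d0e251901756d02056d06056d00056c03b56900056811756501c2f503d0912902f518a56505155a10c56505612d0ec40518a4cd0441290611a103a5650715650005640960f517d5610ad4cd08c5610215610a156100056000055c00055802c2fd01151901a15108d1f11551f11271910082c51d50ad1145550a75550a055500055402010101b5510a055100055000854d00054c00054801c54500054403754124d10d01615d00815d1b25290064dd0020cd0c35410d612d1ed3ed0e115904c54101113106d37501a54124e54100054000053c0005380764b50680b90e952903a5351550c90d25350715350e753500053415453101153100053003b11100035901b1412893a51464411541410c708900237d01a52d15452d01152d08252d00052c2250b906840d0d20a100613104835903c4c501942510c0cd03112903a1a907144d0084412924a108f0d51cd44d0800dd0b44410e222503a52910c22905352900b0bd1294410e73cd0a652606007906007d04447107131103b4e10043e50744dd0404050d73e50003e50001590004e100b4660224e101b4cd16b1590470e50515290644c50004050f75290474051954b50080ed0282fd0513f501a0f90c72c51ab2fd0642fd0664b51372ba0e72dd0080850e74790d71322920d50a05210970d522e4790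d35211355290005280005240080dd2463a504344917d5211bd43e1f211108c5210aa5210215210a15210005200283e51273f605442d0e24c902051d06051d00051c0005180335150005150005140201e501b5110a051100051001a50d00050c00050800050403c5010005000004fc0004f80004f40004f00004ec0374e90004e81ed3990444750643cd02825a1174410510bd0322c10a10c110113106a2b90370850e11a10041f10801f12461a50683710a20c115d1a501912d0634050510950ad2c512a0990a109904c4490ca4710610990f50f50682191b80e51263f53253ea05148906413a0111390644891d431a0b537e0c60812301762c023304222210b08110112d0562310962c508c12d12c15900c16604416505617105614914b3e50a732900007904407d02032901b27906032101a1491094ad0f52910c72a11070a11f43211d41060404ad0002692251552a64b10004b10cf2dd01129a14d0ad0c72311f442503117500b17108f0fd28d0890c02db0002db0442da08110111d3750b64cd0042fd1170790022f208f34e0a73950172910442822ab40500023103417504723106839d0310a90e23112500a500047917244906847910138d02a2e60210dd0960e51032aa03d10503147118a10d0e323102c40524917a0014e601d44900c44923d1590dd34500023f04a23e04c41102117512c4aa1211311013820e31750b619a21347906a4a10f61991aa4a10431311034a10d648229234504c14d0c114d0b641102a2ba0372c50e339d01d17d0ac15106c45907d47518a4e118a4da08144105e0e612c07d0ec07d0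4a17110107d0c10dd1fd0bd03e1310b612902a1d212338a12a41a02121911d29e0712210d744d0a70b50c34113402cf0082ce0c70bd0420ed1953590e73a50a62c11374b138036b04035f1370ee08311a02a0ed1012e51c049712a49604419d3803e33c03272c03271c03271c02973c031f01d31e05644105e32d12c0b508319d0d60bd00c4d90403f10003b90cd4c53001270801273c049f1c049f00749e1950ae04b3920c738d0774910a649a05839513521a08721a0281562923710713990e215508e44d1aa13d04109100c1a503e4a10b617110316d0aa4e11bd4790034710c71cd13746d1232c10304111cb46a0424e50a14e50004e40364e10684e10004e00203f50644d201b4dd2854dd0a04dd0004dc03c4d90434d90004d80c14d50004d40004d00004cc03a4c90004c80b54c51074c50004c401c4590d64c10964c110c4c10004c00774bd0004bd0404bd0004bc01a4b90004b80484b50004b401b4b10004b00204ad0004ac0004a80004a40c34a10004a000049c03a4990004980594750ec28909649510c49508a1190e149500049401749102049106049100049003b48d00048c0a048900048800048400117106a0e504348100048000047c03c47900047800047400047000044d03b2c104046d16745207737d02046d06046d00046c00046803a46500046400046002845d00045c12c45900045800045403b4510004500a044d00044c0c14490004480004440e736507736910105d0213710c308d0a339d0aa0850e108a0232c501e0851170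b52c036f20036f01d36e0f60ee12343513629d10110103e44103c44100044005143d00043c0004380412c10ac43508c22e0b606602c07e08c05906443501b08d1ef41e06408d19443500043403b43108043100043006042d00042c00042800042500042400042010141d00041c00041803a41507141500041400015d08013707306a12f08d0040d905105a12c24e09621902c24a04c3360232e21173b90811821370cd0c73d51f423d0410c90211a91aa1aa0fd1aa2b30e20cc0750a118913d3b50193b50433b50e13b90410751160750442990cc3b505e1b90d63b50011da04c1be08a09502318a0ac2fa0b61ad0ac1d900c3b90360c906c1da1010c906405503b41111840a1e641108041100041000040c0243ae12c3aa03c3b90e31ba1cb0550413b90761b60b24090004080004041174010004000003fc0003f803b3f50803f50003f40003f00603ed0003ec03a3e90003e80003e40213e10003e00003dc0003d81233d50003d41373cd0203d10603d10003d00003cd0003cc0003c801a3c50003c403c3c10003c00003bc0003b80003b401b3b10003b00003ac0003a80003a40003a000039c01a39900039801b3950a039500039404039100039012338d12138d00038c0003880003840003803702ed1cf2aa00c0ed12c2f212c37119417904318204a0f50801951cf0fe2800b324009f06c04a0481a51551690241ca03b1c902f0950571890261cd10517e1581c90b51022291cd02037d00037c0003780d637500037408c37100037000336d00036c0203690603690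0036803a36500036403b36100036000035d00035c00035800035400035000034c0003480c134500034400034000129903c33d04333d00033c00033800033403a33100033000032c03b3290803290003280a132500032419520610713500032104032100032000031c00031800031400031001a30d00030c01b3090a030900030800030401c3010003000802fd0002fc0282f90002f80002f40210ed0ac2f10002f00402ed0002ec0002e806a2e50002e40002e003a2dd0002dc01b2d90a02d90002d81212d50002d40202d10602d10002d00002cc0002c80002c40002c00002bc0032b90832b90002b80002b40d62b10002b00002ac0002a81032990081bd04c0a502b1c91931a103c2a500c2a50002a40202a10602a10002a00962990cc0a503b29d0f429d0ef23500429d00029c00029807603d03121e0e103600e05128929500029400029100029010e28d00028c00028800028400028000027c11727900027803a27500027403c27100027002426d00026c04426900026800026400026000025c00025803725500025400025000024c01c24900024800024401b2410a024100024002023d06023d00023c0002380cc23500023400023000022c00022803a22500022400022000021c00021803c21500021401b2110a021100021000020c00020804020500020401a2010002000001fc0001f80201f50001f40681f10001f00001ec0001e80001e40001e00001dc0001d801b1d50a01d50001d40171850401d10001d00071b20171cd1271a513505505416908b1c60801cd0001cc0001c80001c40001c00001bc0511b90001b801c1b50001b40001b00001ac0001a80001a40d61a10311a10001a000019c0001980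1b1950a019500019404019100019000018c0e207502018900018800418500018400018000017c03c17900c1790001780b60a906c17500017400017003c16d00016c00016800016403b1610801610001600a015d00015c00015803a15500015400015000014c04014900014800014400014001c13d02313d00013c01a1390001380b513500013400013004412d00012c0001280371250f50d10c712500012400012000011c00011803a1150001140001100760b10ec0fd0cc0b10b610906c0451af10d00010c03c1090001080c71050001040241010001000000fc0000f80110f50000f40000f00000ec0000e80000e40000e003a0dd0000dc01b0d90a00d90000d80000d40400d10000d00000690080612860c90b50551470cd0000cc0800c90000c80000c403c0c10000c00000bc0000b80000b40000b00000ad0400ad0000ac03c0a90000a801b0a50000a40000a000009c0200990000980f409500009400009000008c00008800008400008003c07d00007c00007803a07500007400007000006c11706900006800006400006000005c00005800005400005000004c00004801c04500004400004000003c00003803a03500003404001900003104003100003000002c00002800002401a02101102100002004801d00001c01701902001906001900001803b01500401500001400001000000c000009000008000004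

/-- No labels are needed: the subgroup is generated by four of the eight generators, and relators
for it are found among those already known (`relsC_mem`). -/
theorem certH_check : check certH ([]) 266 = true := by decide +kernel

/-- Certificate for a cyclic subgroup of index 132. -/
def certC : Cert where
  ng := 4
  lab := true
  rels := [[0, 6, 4, 0, 7],
    [2, 6, 3, 3, 6],
    [5, 7, 3, 0, 3, 0, 6],
    [4, 1, 1, 5, 2],
    [1, 5, 5, 3, 1],
    [2, 6, 2, 6],
    [3, 3, 3],
    [7, 1, 1, 2, 0, 0, 3, 1, 2],
    [3, 1, 3, 1, 3, 1]]
  gens := [(0, 4, 0)]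
  names := 195
  lw := 2
  wd := 95
  defs := 0xbe60a4509a109630964092107a007220702070506a70686062305c605c705650546054705410502050704c404c304670462044404430426042104250427042003e503e203e003e103e703e403c403c203c703c003a003a503a60383038403870381038003860360036503620363036703660361034303450344034603260327032103200324030703030306030402e702e102e502e202e402c602c002c502c102c702a302a002a402a602a102a702a20286028002600261026402660265024502410244024302460242024002250220022602270222022102060204020302070202020101e501e401e701c301c601c001c701c401a201a301a101a701a401a601840185018101630161016001660165014301410146014701400121012501220126012701200107010401060100010500e100e700e500e600c000c600a000a700a100a5008300870080008200840085006600630061006700620064006500430046004500440042004000410027002600240025002300220003000200070001000600000000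
  len := 628
  steps := 0x203090601e90023090013090813090603090803090003080403050e31d10602b10843050233051033050e03050003042271b91231f51673010833010203010a03010003000032d51042fd0632fd0c22fd0212fd1012fd0c12fd0002fc0412f90a11a51212d50a01fd0c02350222f90c02f90002f81232e104128d0082f50c32f50832f50a22f50202f50002f40c32a90642f11232f11022f11002f10002f00c02ed0a41f50032ed0e22ed0e12ed0a12ed0412ed0002ec0031e10e22e90a12e90412e90002e80e02350832e50601510842e50e02e50002e40802e10412511212e10612e11202e10002e10002e00e21c90212b50012dd0812dd0602dd0802dd0002dc0032051042d90632d90c22d90212d91012d90c12d90002d80202d50621290012d50602d50002d40032ad0c32c50a02d11270d11231791212d10612d11202d10002d01a22c11471fd0e10cd0232cd0e02cd0002cc0a02c908710902114d0012c90812c90602c90802c90002c81232351212c50612c50002c41001d50071d11012a50c72c10c32c10832c10002c01a21250072bd0262bd0452bd0032bd0002bc04414d0a02b91270a12271990822b91202b90002b80032b50412b50c72390822650a32b50432b50002b40632651231c10062b10c22b11012b10002b00800c50472ad1212ad0612ad0002ad0002ac0e22a52072050222a51072a90e22a90a12a90002a80002a400315d0482a10c22a11012a10c12a10002a00e01fd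1230d916215d0260a90a40a90681c10801b90821c110020502025e12320d1231450801790e11990612261021990871990230e600122d08022d0202211071be10020d0030d90e30b10841a90a008d04322102112d0422510432390842390062510c40d51821d10c21b90231d10441210871cd1042350c315d08409506510108429d0c12190011150601661820d90600ad0842210432190e012a0010c60201090421210210f212010e0021160e02390211ba0201450810ae0421511230c50000ad0841ce0a20c51a215518024f00024f0c024e00717104527a1c01071001070c01071400ff1000ff10026f0c026f08026f1a226e0821c62271f902325d0801090e30ed0c01ed0a42610401d50031ed1000990c229d0011c90c117500024d0200951621e10441cd0442490e41520c328d1041f90a41f90802130801760631750c41f20681751401870001870841861231811e71f51011810201bd0200b506823d1800930c009308009300018b1c013310013310013200724618728d08414112020d1401af1001af0401af0001af0401b70c00c30800c30400c31801b31821b21011491221290481560871550201550801971800df0400df0000df0e20de10025a0070d100029a1a229d00129d00029c00029800029400029000028c0002880a128500028404525512221904028100028002027d00027c0002780002740002700a426d0a126d00026c0002690002680642651232650e326500026406426112326110226100026000025c0012590002581230790062550002540a325100025000024c0200890c41050832490002480e324500024400024000023c0002380a12350002340052290812290a407504009106323100023000022c0002280002240c122100022000021c1000f50c0219000218000214001211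00021012120d00020c0082090832090002081000e50840fd0e312d0831190841ad0031c51e72050002040a41ad0a32010002001201fd0001fc0061f90001f80250890420ed0271f50001f40a31f10001f00001ec0231410441e90201e90001e80001e40e21e10a11e10001e00001dc0011d90001d80001d40001d01011611221cd0001cc0001c80061c50001c40e31c10001c00001bc0001b80001b40001b00001ac0001a80640b90e31a50001a40001a008319d00019c0c414a0a319900019800119500019400019000018c0a01890001880c01850001840c118100018000017c0411790001780001740c417100017000016c00016812016500016402616100316100016000015c00015800015400615100015000014c0001480001440001400230450e413d04313d00013c00013800613500013400013000012c0001280a312500012402612100012000011c00011800011400011000010c0221090001080001040201010001000c10fd0000fc00308d0a00f90000f80000f40000f00c40ed0000ec0060e90000e80830e50000e40000e01200dd0000dc0e30d90000d80000d40c40d10000d00a40590030cd0a10cd0000cc0050c90000c81200c50000c40000c01230391210bd0000bc0000b808009f0e209e06009d0020b50010b50000b40000b00230ad0000ac0440a90000a80000a40000a000109d00009c0640610e309900009800109500009400009000008c00008800008400608102108100008000007c04007900007800007400007000006c06006900006800606500006400005d0c306100006000005c0000580000540840511030510000500c104d00004c00004800004400004004103d00003c0000380a003500003400003100003000002c0000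2800002404802100602100002000001c00301500601910401900001800001400001000000c000008000004

/-- The query traces a relator at the coset 194; its label is the 15th power of the single
generator, which bounds the cyclic group at the bottom of the chain. -/
theorem certC_check : check certC ([(194, [1, 5, 5, 3, 1], [0, 0, 0, 0, 0, 0, 0, 0, 0, 0, 0, 0, 0, 0, 0])]) 132 = true := by decide +kernel

/-! ### Values of words in a group -/

section words
variable {G : Type*} [Group G] (g : ℕ → G)

/-- Value of a letter. -/
def letter (x : ℕ) : G := if x % 2 = 0 then g (x / 2) else (g (x / 2))⁻¹

/-- Value of a word. -/
def ev (l : List ℕ) : G := (l.map (letter g)).prod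

@[simp] theorem ev_nil : ev g [] = 1 := rfl

@[simp] theorem ev_cons (x : ℕ) (l : List ℕ) : ev g (x :: l) = letter g x * ev g l := by
  simp [ev]

theorem ev_append (l m : List ℕ) : ev g (l ++ m) = ev g l * ev g m := by simp [ev]

theorem letter_flip (x : ℕ) : letter g (flip x) = (letter g x)⁻¹ := by
  unfold letter flip
  rcases Nat.mod_two_eq_zero_or_one x with h | h
  · have h1 : (x + 1 - 2 * (x % 2)) % 2 ≠ 0 := by omega
    have h2 : (x + 1 - 2 * (x % 2)) / 2 = x / 2 := by omega
    rw [if_neg h1, if_pos h, h2]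
  · have h1 : (x + 1 - 2 * (x % 2)) % 2 = 0 := by omega
    have h2 : (x + 1 - 2 * (x % 2)) / 2 = x / 2 := by omega
    have h3 : x % 2 ≠ 0 := by omega
    rw [if_pos h1, if_neg h3, h2, inv_inv]

theorem ev_invWord (l : List ℕ) : ev g (invWord l) = (ev g l)⁻¹ := by
  induction l with
  | nil => simp [invWord]
  | cons x l ih =>
    have : invWord (x :: l) = invWord l ++ [flip x] := by simp [invWord]
    rw [this, ev_append, ih]; simp [letter_flip]

theorem ev_push (x : ℕ) (l : List ℕ) : ev g (push x l) = letter g x * ev g l := by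
  cases l with
  | nil => simp [push]
  | cons y t =>
    simp only [push]
    split
    · rename_i h
      rw [Nat.eq_of_beq_eq_true h]; simp [letter_flip]
    · simp

theorem ev_foldr_push (l m : List ℕ) : ev g (l.foldr push m) = ev g l * ev g m := by
  induction l with
  | nil => simp
  | cons x l ih => simp [ev_push, ih, mul_assoc]

theorem eq_of_eqWord : ∀ {l m : List ℕ}, eqWord l m = true → l = m
  | [], [], _ => rfl
  | x :: l, y :: m, h => by
    simp only [eqWord, Bool.and_eq_true] at h
    rw [Nat.eq_of_beq_eq_true h.1, eq_of_eqWord h.2]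
  | [], _ :: _, h => by simp [eqWord] at h
  | _ :: _, [], h => by simp [eqWord] at h

theorem ev_mem_closure (l : List ℕ) : ev g l ∈ Subgroup.closure (Set.range g) := by
  apply Subgroup.list_prod_mem
  intro z hz
  obtain ⟨x, -, rfl⟩ := List.mem_map.1 hz
  unfold letter
  split
  · exact Subgroup.subset_closure ⟨_, rfl⟩
  · exact Subgroup.inv_mem _ (Subgroup.subset_closure ⟨_, rfl⟩)

end words

/-! ### Reading and writing entries of a table stored as a number -/

section table
variable (C : Cert)

theorem get_eq (T k : ℕ) : get C T k = (T >>> (C.wd * k)) % 2 ^ C.wd := rfl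

theorem put_eq (T k e : ℕ) : put C T k e = T ^^^ ((get C T k ^^^ e) <<< (C.wd * k)) := rfl

theorem get_lt (T k : ℕ) : get C T k < 2 ^ C.wd := Nat.mod_lt _ (Nat.two_pow_pos _)

theorem get_put_same {T k e : ℕ} (he : e < 2 ^ C.wd) : get C (put C T k e) k = e := by
  rw [get_eq, put_eq, Nat.shiftRight_xor_distrib, Nat.shiftLeft_shiftRight, Nat.xor_mod_two_pow,
    ← get_eq, Nat.mod_eq_of_lt (Nat.xor_lt_two_pow (get_lt C T k) he), ← Nat.xor_assoc]
  simp

/-- The entries occupy disjoint ranges of `C.wd` bits, and the xor mask is short enough to touch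
only the range of `k`. -/
theorem get_put_ne {T k k' e : ℕ} (he : e < 2 ^ C.wd) (hk : k' ≠ k) :
    get C (put C T k e) k' = get C T k' := by
  have hx : get C T k ^^^ e < 2 ^ C.wd := Nat.xor_lt_two_pow (get_lt C T k) he
  rw [get_eq, put_eq, Nat.shiftRight_xor_distrib, Nat.xor_mod_two_pow, ← get_eq]
  suffices h : ((get C T k ^^^ e) <<< (C.wd * k)) >>> (C.wd * k') % 2 ^ C.wd = 0 by
    rw [h, Nat.xor_zero]
  apply Nat.eq_of_testBit_eq
  intro i
  rw [Nat.testBit_mod_two_pow, Nat.testBit_shiftRight, Nat.testBit_shiftLeft, Nat.zero_testBit]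
  by_cases hi : i < C.wd
  · rcases lt_or_gt_of_ne hk with h | h
    · have h1 : C.wd * (k' + 1) ≤ C.wd * k := Nat.mul_le_mul_left _ h
      have h2 : ¬ (C.wd * k' + i ≥ C.wd * k) := by rw [mul_add] at h1; omega
      simp [h2]
    · have h1 : C.wd * (k + 1) ≤ C.wd * k' := Nat.mul_le_mul_left _ h
      have h2 : C.wd ≤ C.wd * k' + i - C.wd * k := by rw [mul_add] at h1; omega
      have := Nat.testBit_lt_two_pow (lt_of_lt_of_le hx (Nat.pow_le_pow_right (by norm_num) h2))
      simp [this]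
  · simp [hi]

end table

/-! ### Soundness of the deductions -/

section sound
variable (C : Cert) {G : Type*} [Group G] (g h : ℕ → G)

/-- Coset representatives. -/
def rep : ℕ → G
  | 0 => 1
  -- The test ensures termination for arbitrary data; where it fails, `opDef` sets no edge, so the
  -- default 1 is harmless.
  | k + 1 => if C.par (k + 1) / 32 < k + 1 then
      rep (C.par (k + 1) / 32) * letter g (C.par (k + 1) % 32) else 1

/-- The element `z` of the subgroup has the label `l`. -/
def HasLab (l : List ℕ) (z : G) : Prop := match C.lab with
  | true => z = ev h l
  | false => z ∈ Subgroup.closure (Set.range h)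

/-- The edge from `a` by `x` to `b` with the label `l` is correct. -/
def EdgeOK (a x b : ℕ) (l : List ℕ) : Prop :=
  HasLab C h l (rep C g a * letter g x * (rep C g b)⁻¹)

/-- All edges of the table are correct. -/
def Valid (T : ℕ) : Prop := ∀ k e, get C T k = e + 1 →
  EdgeOK C g h (k / C.row) (k % C.row) (e % 1024) (dec C (e / 1024))

variable {C g h}

theorem HasLab.mem {l : List ℕ} {z : G} (H : HasLab C h l z) :
    z ∈ Subgroup.closure (Set.range h) := by
  unfold HasLab at H
  split at H
  · rw [H]; exact ev_mem_closure h l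
  · exact H

theorem hasLab_one : HasLab C h [] 1 := by
  unfold HasLab; split
  · rfl
  · exact one_mem _

theorem HasLab.mul {l l' : List ℕ} {z z' : G} (H : HasLab C h l z) (H' : HasLab C h l' z') :
    HasLab C h (mulLab C l l') (z * z') := by
  unfold HasLab mulLab at *
  cases hC : C.lab <;> simp only [hC] at H H' ⊢
  · exact mul_mem H H'
  · rw [H, H', ev_foldr_push]

theorem HasLab.inv {l : List ℕ} {z : G} (H : HasLab C h l z) :
    HasLab C h (invLab C l) z⁻¹ := by
  unfold HasLab invLab at *
  cases hC : C.lab <;> simp only [hC] at H ⊢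
  · exact inv_mem H
  · rw [H, ev_invWord]

theorem hasLab_gen (j : ℕ) : HasLab C h (genLab C j) (h j) := by
  unfold HasLab genLab
  cases hC : C.lab <;> simp only
  · exact Subgroup.subset_closure ⟨j, rfl⟩
  · simp [letter]

theorem Valid.edge {T : ℕ} (H : Valid C g h T) {a x e : ℕ} (hx : x < C.row)
    (he : get C T (a * C.row + x) = e + 1) :
    EdgeOK C g h a x (e % 1024) (dec C (e / 1024)) := by
  have := H _ _ he
  have h0 : 0 < C.row := by unfold Cert.row; omega
  rwa [Nat.add_comm, Nat.add_mul_div_right _ _ h0, Nat.div_eq_of_lt hx, Nat.zero_add,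
    Nat.add_mul_mod_self_right, Nat.mod_eq_of_lt hx] at this

/-- The guards in `setE` are what is needed to decode the written entry; if one fails, the table is
unchanged. -/
theorem Valid.setE {T : ℕ} (H : Valid C g h T) {a x b : ℕ} {l : List ℕ}
    (hE : EdgeOK C g h a x b l) : Valid C g h (setE C T a x b l) := by
  unfold CosetCert.setE
  split
  · rename_i hc
    simp only [Bool.and_eq_true, Nat.blt_eq] at hc
    obtain ⟨hb, hx, he, hl⟩ := hc
    have hl := eq_of_eqWord hl
    have h0 : 0 < C.row := by omega
    intro k e hk
    by_cases hkk : k = a * C.row + x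
    · subst hkk
      rw [get_put_same C he] at hk
      have h1 : e = b + 1024 * enc C l := by omega
      have h2 : e % 1024 = b := by rw [h1]; omega
      have h3 : e / 1024 = enc C l := by rw [h1]; omega
      rw [h2, h3, hl, Nat.add_comm, Nat.add_mul_div_right _ _ h0, Nat.div_eq_of_lt hx,
        Nat.zero_add, Nat.add_mul_mod_self_right, Nat.mod_eq_of_lt hx]
      exact hE
    · rw [get_put_ne C he hkk] at hk
      exact H k e hk
  · exact H

theorem Valid.fill {T : ℕ} (H : Valid C g h T) {a x b : ℕ} {l : List ℕ}
    (hE : EdgeOK C g h a x b l) : Valid C g h (fill C T a x b l) := by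
  unfold CosetCert.fill
  split
  · exact H.setE hE
  · exact H

theorem EdgeOK.flip {a x b : ℕ} {l : List ℕ} (hE : EdgeOK C g h a x b l) :
    EdgeOK C g h b (flip x) a (invLab C l) := by
  have := HasLab.inv hE
  unfold EdgeOK
  rw [letter_flip]
  convert this using 1
  group

/-- The representatives of `a` and `b` differ by an element with label `l`. -/
def Eqv (C : Cert) (g h : ℕ → G) (a b : ℕ) (l : List ℕ) : Prop :=
  HasLab C h l (rep C g a * (rep C g b)⁻¹)

/-- The last column of the table belongs to a letter with value 1. A coincidence is thus an ordinary
edge, and `Valid` covers it without a separate clause. -/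
theorem letter_nc (hg : g C.ng = 1) : letter g C.nc = 1 := by
  simp [letter, Cert.nc, hg]

theorem eqv_iff (hg : g C.ng = 1) {a b : ℕ} {l : List ℕ} :
    EdgeOK C g h a C.nc b l ↔ Eqv C g h a b l := by
  simp [EdgeOK, Eqv, letter_nc hg]

theorem Eqv.refl (a : ℕ) : Eqv C g h a a [] := by
  simpa [Eqv] using hasLab_one

/-- `norm`, `step` and `walk` are written with raw recursors for evaluation; these equations restore
the case distinctions. -/
theorem norm_succ (T f b : ℕ) (l : List ℕ) : norm C T (f + 1) b l =
    match get C T (b * C.row + C.nc) with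
    | 0 => (b, l)
    | e + 1 => norm C T f (e % 1024) (mulLab C l (dec C (e / 1024))) := by
  have : norm C T (f + 1) b l = Nat.rec (motive := fun _ => ℕ × List ℕ) (b, l)
      (fun e _ => norm C T f (e % 1024) (mulLab C l (dec C (e / 1024))))
      (get C T (b * C.row + C.nc)) := rfl
  rw [this]
  cases get C T (b * C.row + C.nc) <;> rfl

theorem step_eq (T a x : ℕ) (l : List ℕ) : step C T a x l =
    match get C T (a * C.row + x) with
    | 0 => none
    | e + 1 => some (norm C T 8 (e % 1024) (mulLab C l (dec C (e / 1024)))) := by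
  have : step C T a x l = Nat.rec (motive := fun _ => Option (ℕ × List ℕ)) none
      (fun e _ => some (norm C T 8 (e % 1024) (mulLab C l (dec C (e / 1024)))))
      (get C T (a * C.row + x)) := rfl
  rw [this]
  cases get C T (a * C.row + x) <;> rfl

theorem walk_nil (T a : ℕ) (l : List ℕ) : walk C T a l [] = some (a, l) := rfl

theorem walk_cons (T a : ℕ) (l : List ℕ) (x : ℕ) (w : List ℕ) : walk C T a l (x :: w) =
    match step C T a x l with
    | none => none
    | some (b, m) => walk C T b m w := by
  have : walk C T a l (x :: w) = Option.rec (motive := fun _ => Option (ℕ × List ℕ)) none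
      (fun p => Prod.rec (motive := fun _ => Option (ℕ × List ℕ)) (fun b m => walk C T b m w) p)
      (step C T a x l) := rfl
  rw [this]
  cases step C T a x l <;> rfl

/-- The element `z` is fixed and equals its label times the current representative; each coincidence
moves a factor into the label. Running out of fuel does no harm, as every intermediate pair is
correct. -/
theorem Valid.norm (hg : g C.ng = 1) {T : ℕ} (H : Valid C g h T) : ∀ (f b : ℕ) (l : List ℕ) (z : G),
    HasLab C h l (z * (rep C g b)⁻¹) →
    HasLab C h (norm C T f b l).2 (z * (rep C g (norm C T f b l).1)⁻¹)
  | 0, _, _, _, hz => hz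
  | f + 1, b, l, z, hz => by
    rw [norm_succ]
    split
    · exact hz
    · rename_i e he
      apply H.norm hg f
      have h1 := H.edge (by unfold Cert.nc Cert.row; omega) he
      rw [eqv_iff hg] at h1
      convert hz.mul h1 using 1
      group

theorem Valid.step (hg : g C.ng = 1) {T : ℕ} (H : Valid C g h T) {a x b : ℕ} {l m : List ℕ} {z : G}
    (hx : x < C.row) (hz : HasLab C h l (z * (rep C g a)⁻¹)) (hs : step C T a x l = some (b, m)) :
    HasLab C h m (z * letter g x * (rep C g b)⁻¹) := by
  rw [step_eq] at hs
  split at hs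
  · simp at hs
  · rename_i e he
    simp only [Option.some.injEq] at hs
    have h1 : HasLab C h (mulLab C l (dec C (e / 1024)))
        (z * letter g x * (rep C g (e % 1024))⁻¹) := by
      convert hz.mul (H.edge hx he) using 1
      group
    have h2 := H.norm hg 8 _ _ _ h1
    rwa [hs] at h2

end sound
section sound2
variable {C : Cert} {G : Type*} [Group G] {g h : ℕ → G}

theorem Valid.walk (hg : g C.ng = 1) {T : ℕ} (H : Valid C g h T) {b : ℕ} {m : List ℕ} :
    ∀ (w : List ℕ) (a : ℕ) (l : List ℕ) (z : G), (∀ x ∈ w, x < C.row) →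
    HasLab C h l (z * (rep C g a)⁻¹) → walk C T a l w = some (b, m) →
    HasLab C h m (z * ev g w * (rep C g b)⁻¹)
  | [], a, l, z, _, hz, hs => by
    rw [walk_nil] at hs
    simp only [Option.some.injEq, Prod.mk.injEq] at hs
    obtain ⟨rfl, rfl⟩ := hs
    simpa using hz
  | x :: w, a, l, z, hw, hz, hs => by
    rw [walk_cons] at hs
    split at hs
    · simp at hs
    · rename_i b' m' hb
      have h1 := H.step hg (hw x (by simp)) hz hb
      have := H.walk hg w b' m' _ (fun y hy => hw y (by simp [hy])) h1 hs
      simpa [mul_assoc] using this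

theorem Eqv.symm {a b : ℕ} {l : List ℕ} (H : Eqv C g h a b l) : Eqv C g h b a (invLab C l) := by
  have := HasLab.inv H
  unfold Eqv
  convert this using 1
  group

theorem Valid.copyEdges {a b : ℕ} {l : List ℕ} (hE : Eqv C g h b a l) :
    ∀ (n T : ℕ), n ≤ C.nc → Valid C g h T → Valid C g h (copyEdges C a b l n T)
  | 0, _, _, H => H
  | y + 1, T, hn, H => by
    unfold CosetCert.copyEdges
    apply Valid.copyEdges hE y _ (by omega)
    split
    · exact H
    · rename_i e he
      apply H.fill
      have h1 := HasLab.mul hE (H.edge (by unfold Cert.nc at hn; unfold Cert.row; omega) he)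
      unfold EdgeOK
      convert h1 using 1
      group

/-- Nothing is overwritten by copying, and either direction of the coincidence is correct by
inverting its label. -/
theorem Valid.merge (hg : g C.ng = 1) {T : ℕ} (H : Valid C g h T) {a b : ℕ} {l : List ℕ}
    (hE : Eqv C g h a b l) : Valid C g h (merge C T a b l) := by
  unfold CosetCert.merge
  split
  · exact Valid.copyEdges hE _ _ le_rfl (H.setE ((eqv_iff hg).2 hE.symm))
  · exact Valid.copyEdges hE.symm _ _ le_rfl (H.setE ((eqv_iff hg).2 hE))

theorem Valid.opDef {T : ℕ} (H : Valid C g h T) (k : ℕ) : Valid C g h (opDef C T k) := by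
  unfold CosetCert.opDef
  split
  · rename_i hk
    rw [Nat.blt_eq] at hk
    obtain ⟨k, rfl⟩ : ∃ j, k = j + 1 := ⟨k - 1, by omega⟩
    have hr : rep C g (k + 1) =
        rep C g (C.par (k + 1) / 32) * letter g (C.par (k + 1) % 32) := by
      rw [rep, if_pos hk]
    apply (H.setE _).fill
    · unfold EdgeOK
      rw [hr, letter_flip]
      convert hasLab_one (C := C) (h := h) using 1
      group
    · unfold EdgeOK
      rw [hr]
      convert hasLab_one (C := C) (h := h) using 1
      group
  · exact H

theorem lt_of_lettersOK : ∀ {l : List ℕ}, lettersOK C l = true → ∀ x ∈ l, x < C.nc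
  | [], _, x, hx => by simp at hx
  | y :: l, hl, x, hx => by
    simp only [lettersOK, Bool.and_eq_true, Nat.blt_eq] at hl
    rcases List.mem_cons.1 hx with rfl | hx
    · exact hl.1
    · exact lt_of_lettersOK hl.2 x hx

theorem lettersOK_of_relsOK : ∀ {R : List (List ℕ)}, relsOK C R = true →
    ∀ w ∈ R, lettersOK C w = true
  | [], _, x, hx => by simp at hx
  | y :: l, hl, x, hx => by
    simp only [relsOK, Bool.and_eq_true] at hl
    rcases List.mem_cons.1 hx with rfl | hx
    · exact hl.1
    · exact lettersOK_of_relsOK hl.2 x hx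

theorem flip_lt {x : ℕ} (hx : x < C.nc) : flip x < C.nc := by
  unfold flip; unfold Cert.nc at *; omega

theorem invWord_lt {w : List ℕ} (hw : ∀ x ∈ w, x < C.nc) : ∀ x ∈ invWord w, x < C.nc := by
  intro x hx
  simp only [invWord, List.mem_reverse, List.mem_map] at hx
  obtain ⟨y, hy, rfl⟩ := hx
  exact flip_lt (hw y hy)

theorem relWord_lt (hR : relsOK C C.rels = true) (i f k : ℕ) :
    ∀ x ∈ relWord C i f k, x < C.nc := by
  have h0 : ∀ x ∈ C.rels.getD i [], x < C.nc := by
    rw [List.getD_eq_getElem?_getD]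
    cases hi : C.rels[i]? with
    | none => simp
    | some w =>
      exact lt_of_lettersOK (lettersOK_of_relsOK hR w (List.mem_of_getElem? hi))
  have h1 : ∀ u : List ℕ, (∀ x ∈ u, x < C.nc) → ∀ x ∈ u.drop k ++ u.take k, x < C.nc := by
    intro u hu x hx
    rcases List.mem_append.1 hx with hx | hx
    · exact hu x (List.mem_of_mem_drop hx)
    · exact hu x (List.mem_of_mem_take hx)
  unfold relWord
  apply h1
  split
  · exact h0
  · exact invWord_lt h0

/-- From $uv=1$ follows $vu=1$, so rotations of relators are relators. -/
theorem ev_relWord (hrel : ∀ w ∈ C.rels, ev g w = 1) (i f k : ℕ) : ev g (relWord C i f k) = 1 := by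
  have h0 : ev g (C.rels.getD i []) = 1 := by
    rw [List.getD_eq_getElem?_getD]
    cases hi : C.rels[i]? with
    | none => simp
    | some w => exact hrel w (List.mem_of_getElem? hi)
  have h1 : ∀ u : List ℕ, ev g u = 1 → ev g (u.drop k ++ u.take k) = 1 := by
    intro u hu
    rw [← List.take_append_drop k u, ev_append] at hu
    rw [ev_append]
    exact mul_eq_one_comm.1 hu
  unfold relWord
  apply h1
  split
  · exact h0
  · rw [ev_invWord, h0, inv_one]

theorem Valid.opEdge (hg : g C.ng = 1) {T : ℕ} (H : Valid C g h T) (a : ℕ) {u : List ℕ}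
    (hu : ∀ x ∈ u, x < C.nc) (hev : ev g u = 1) : Valid C g h (opEdge C T a u) := by
  unfold CosetCert.opEdge
  split
  · exact H
  · rename_i x v
    split
    · exact H
    · rename_i b l hw
      have hv : ∀ y ∈ invWord v, y < C.row := fun y hy => by
        have := invWord_lt (fun z hz => hu z (by simp [hz])) y hy
        unfold Cert.nc at this; unfold Cert.row; omega
      have h1 := H.walk hg (invWord v) a [] (rep C g a) hv (Eqv.refl a) hw
      -- The relator is `x` followed by `v`, so `x` acts as the inverse of `v`, along which the path
      -- was traced.
      have h2 : letter g x = ev g (invWord v) := by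
        rw [ev_invWord]
        exact eq_inv_of_mul_eq_one_left (by simpa using hev)
      have h3 : EdgeOK C g h a x b l := by
        unfold EdgeOK; rwa [h2]
      exact (H.setE h3).fill h3.flip

theorem Valid.opCoin (hg : g C.ng = 1) {T : ℕ} (H : Valid C g h T) (a : ℕ) {u : List ℕ}
    (hu : ∀ x ∈ u, x < C.nc) (hev : ev g u = 1) : Valid C g h (opCoin C T a u) := by
  unfold CosetCert.opCoin
  split
  · exact H
  · rename_i b l hw
    have h1 := H.walk hg u a [] (rep C g a)
      (fun x hx => by have := hu x hx; unfold Cert.nc at this; unfold Cert.row; omega)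
      (Eqv.refl a) hw
    rw [hev, mul_one] at h1
    exact H.merge hg h1

/-- The coset `c` and its survivor `c'` have edges by the same letter `y`; comparing the two targets
and labels identifies the targets. -/
theorem Valid.opCong (hg : g C.ng = 1) {T : ℕ} (H : Valid C g h T) (c y : ℕ) :
    Valid C g h (opCong C T c y) := by
  unfold CosetCert.opCong
  split
  · exact H
  · rename_i hy
    rw [Nat.blt_eq] at hy
    split
    · exact H
    · rename_i e he
      have h1 := H.norm hg 8 _ _ _ (H.edge hy he)
      have h2 := H.norm hg 8 c [] _ (Eqv.refl c)
      split
      rename_i a l c' m ha hc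
      rw [ha] at h1
      rw [hc] at h2
      split
      · exact H
      · rename_i b l' hb
        have h3 := H.step hg hy h2 hb
        apply H.merge hg
        have := h1.inv.mul h3
        unfold Eqv
        convert this using 1
        group

theorem Valid.doOp (hg : g C.ng = 1) (hR : relsOK C C.rels = true)
    (hrel : ∀ w ∈ C.rels, ev g w = 1) {T : ℕ} (H : Valid C g h T) (n : ℕ) :
    Valid C g h (doOp C T n) := by
  unfold CosetCert.doOp
  split
  · exact H.opDef _
  · exact H.opEdge hg _ (relWord_lt hR _ _ _) (ev_relWord hrel _ _ _)
  · exact H.opCoin hg _ (relWord_lt hR _ _ _) (ev_relWord hrel _ _ _)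
  · exact H.opCong hg _ _

theorem valid_zero : Valid C g h 0 := by
  intro k e hk
  simp [get_eq] at hk

theorem Valid.run (hg : g C.ng = 1) (hR : relsOK C C.rels = true)
    (hrel : ∀ w ∈ C.rels, ev g w = 1) :
    ∀ (n i T : ℕ), Valid C g h T → Valid C g h (run C n i T)
  | 0, _, _, H => H
  | n + 1, i, T, H => by
    unfold CosetCert.run
    have := H.doOp hg hR hrel ((C.steps >>> (24 * i)) % 16777216)
    split
    · exact valid_zero
    · rename_i t ht
      rw [ht] at this
      exact Valid.run hg hR hrel n (i + 1) _ this

/-- The first edges are true by the choice of the subgroup generators: each one is defined as the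
discrepancy along its edge. -/
theorem Valid.initT : ∀ (j : ℕ) (l : List (ℕ × ℕ × ℕ)) (T : ℕ),
    (∀ i c x d, l[i]? = some (c, x, d) →
      h (j + i) = rep C g c * letter g x * (rep C g d)⁻¹) →
    Valid C g h T → Valid C g h (initT C j l T)
  | _, [], _, _, H => H
  | j, (c, x, d) :: t, T, hl, H => by
    unfold CosetCert.initT
    apply Valid.initT (j + 1) t
    · intro i c' x' d' hi
      rw [← hl (i + 1) c' x' d' (by simpa using hi)]
      congr 1
      omega
    · have h1 : EdgeOK C g h c x d (genLab C j) := by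
        unfold EdgeOK
        rw [← hl 0 c x d (by simp)]
        exact hasLab_gen j
      exact (H.setE h1).fill h1.flip

theorem mem_live {T a : ℕ} (hl : isLive C T a = true) : ∀ {n : ℕ}, a < n → a ∈ live C T n
  | n + 1, ha => by
    unfold live
    rcases Nat.lt_succ_iff_lt_or_eq.1 ha with ha | rfl
    · have := mem_live hl ha
      split
      · exact List.mem_cons_of_mem _ this
      · exact this
    · simp [hl]

theorem closedAt_of_closedAll {T a : ℕ} : ∀ {l : List ℕ}, closedAll C T l = true → a ∈ l →
    closedAt C T a C.nc = true
  | b :: l, hc, ha => by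
    simp only [closedAll, Bool.and_eq_true] at hc
    rcases List.mem_cons.1 ha with rfl | ha
    · exact hc.1
    · exact closedAt_of_closedAll hc.2 ha

theorem step_of_closedAt {T a x : ℕ} : ∀ {n : ℕ}, closedAt C T a n = true → x < n →
    ∃ b m, step C T a x [] = some (b, m) ∧ isLive C T b = true
  | n + 1, hc, hx => by
    simp only [closedAt, Bool.and_eq_true] at hc
    rcases Nat.lt_succ_iff_lt_or_eq.1 hx with hx | rfl
    · exact step_of_closedAt hc.2 hx
    · have h1 := hc.1
      split at h1
      · simp at h1
      · rename_i b m hb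
        exact ⟨b, m, hb, h1⟩

/-- A complete table describes a covering by cosets. -/
theorem Valid.cover (hg : ∀ i, C.ng ≤ i → g i = 1) {T m : ℕ} (H : Valid C g h T)
    (hT : isComplete C m T = true) : ∃ L : List ℕ, L.length = m ∧
      ∀ z ∈ Subgroup.closure (Set.range g), ∃ a ∈ L,
        z * (rep C g a)⁻¹ ∈ Subgroup.closure (Set.range h) := by
  simp only [isComplete, Bool.and_eq_true] at hT
  obtain ⟨h0, hcl, hm⟩ := hT
  have hlt : ∀ a, isLive C T a = true → a < C.names := by
    intro a ha
    simp only [isLive, Bool.and_eq_true, Nat.blt_eq] at ha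
    exact ha.1
  refine ⟨_, Nat.eq_of_beq_eq_true hm, ?_⟩
  -- Since the table is closed, a letter leads from a covered element to a covered one; the claim
  -- follows by induction on products of generators. Disjointness of the cosets is not claimed.
  have key : ∀ (z : G) (x : ℕ), x < C.nc →
      (∃ a ∈ live C T C.names, z * (rep C g a)⁻¹ ∈ Subgroup.closure (Set.range h)) →
      ∃ a ∈ live C T C.names, z * letter g x * (rep C g a)⁻¹ ∈ Subgroup.closure (Set.range h) := by
    rintro z x hx ⟨a, ha, hz⟩
    obtain ⟨b, m, hb, hbl⟩ := step_of_closedAt (closedAt_of_closedAll hcl ha) hx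
    refine ⟨b, mem_live hbl (hlt b hbl), ?_⟩
    have h1 := (H.step (hg _ le_rfl) (by unfold Cert.nc at hx; unfold Cert.row; omega)
      (Eqv.refl a) hb).mem
    have h2 := mul_mem hz h1
    convert h2 using 1
    group
  intro z hz
  induction hz using Subgroup.closure_induction_right with
  | one => exact ⟨0, mem_live h0 (hlt 0 h0), by simp [rep]⟩
  | mul_right z hz y hy ih =>
    obtain ⟨i, rfl⟩ := hy
    rcases lt_or_ge i C.ng with hi | hi
    · have := key z (2 * i) (by unfold Cert.nc; omega) ih
      simpa [letter] using this
    · simpa [hg i hi] using ih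
  | mul_inv_cancel z hz y hy ih =>
    obtain ⟨i, rfl⟩ := hy
    rcases lt_or_ge i C.ng with hi | hi
    · have := key z (2 * i + 1) (by unfold Cert.nc; omega) ih
      have h2 : (2 * i + 1) / 2 = i := by omega
      simpa [letter, h2] using this
    · simpa [hg i hi] using ih

theorem queriesOK_sound (hg : g C.ng = 1) {T : ℕ} (H : Valid C g h T) :
    ∀ {Q : List (ℕ × List ℕ × List ℕ)}, queriesOK C T Q = true → ∀ c w l, (c, w, l) ∈ Q →
      HasLab C h l (rep C g c * ev g w * (rep C g c)⁻¹)
  | (c', w', l') :: t, hQ, c, w, l, hq => by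
    simp only [queriesOK, Bool.and_eq_true] at hQ
    rcases List.mem_cons.1 hq with hq | hq
    · obtain ⟨rfl, rfl, rfl⟩ : c = c' ∧ w = w' ∧ l = l' := by simpa using hq
      have h1 := hQ.1
      split at h1
      · simp at h1
      · rename_i b m hb
        simp only [Bool.and_eq_true] at h1
        have h2 := H.walk hg w c [] (rep C g c)
          (fun x hx => by
            have := lt_of_lettersOK h1.1 x hx
            unfold Cert.nc at this; unfold Cert.row; omega) (Eqv.refl c) hb
        rw [Nat.eq_of_beq_eq_true h1.2.1, eq_of_eqWord h1.2.2] at h2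
        exact h2
    · exact queriesOK_sound hg H hQ.2 c w l hq

theorem check_sound {Q : List (ℕ × List ℕ × List ℕ)} {m : ℕ} (hc : check C Q m = true)
    (hg : ∀ i, C.ng ≤ i → g i = 1) (hrel : ∀ w ∈ C.rels, ev g w = 1)
    (hh : ∀ i c x d, C.gens[i]? = some (c, x, d) →
      h i = rep C g c * letter g x * (rep C g d)⁻¹) :
    (∀ c w l, (c, w, l) ∈ Q → HasLab C h l (rep C g c * ev g w * (rep C g c)⁻¹)) ∧
    (m ≠ 0 → ∃ L : List ℕ, L.length = m ∧ ∀ z ∈ Subgroup.closure (Set.range g), ∃ a ∈ L,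
        z * (rep C g a)⁻¹ ∈ Subgroup.closure (Set.range h)) := by
  unfold check at hc
  split at hc
  · simp at hc
  · rename_i t ht
    simp only [Bool.and_eq_true, Bool.or_eq_true] at hc
    obtain ⟨⟨hR, hQ⟩, hm⟩ := hc
    have hg' := hg _ le_rfl
    have H : Valid C g h t.succ := by
      rw [← ht]
      exact Valid.run hg' hR hrel _ _ _ (Valid.initT 0 _ _ (by simpa using hh) valid_zero)
    refine ⟨queriesOK_sound hg' H hQ, fun hm0 => H.cover hg ?_⟩
    rcases hm with hm | hm
    · exact absurd (Nat.eq_of_beq_eq_true hm) hm0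
    · exact hm

end sound2

/-! ### Counting along the chain of subgroups -/

/-- A set covered by `m` translates of a set with at most `n` elements. -/
theorem finite_of_cover {G : Type*} [Group G] {A B : Subgroup G} {n m : ℕ} (r : ℕ → G)
    (L : List ℕ) (hL : L.length = m) (hcov : ∀ z ∈ A, ∃ a ∈ L, z * (r a)⁻¹ ∈ B)
    (hB : (B : Set G).Finite ∧ (B : Set G).ncard ≤ n) :
    (A : Set G).Finite ∧ (A : Set G).ncard ≤ m * n := by
  classical
  have hsub : (A : Set G) ⊆ ↑((L.toFinset ×ˢ hB.1.toFinset).image (fun p => p.2 * r p.1)) := by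
    intro z hz
    obtain ⟨a, ha, hza⟩ := hcov z hz
    simp only [Finset.coe_image, Set.mem_image]
    exact ⟨(a, z * (r a)⁻¹), by simp [ha]; exact hza, by simp⟩
  refine ⟨(Finset.finite_toSet _).subset hsub, (Set.ncard_le_ncard hsub).trans ?_⟩
  rw [Set.ncard_coe_finset]
  refine Finset.card_image_le.trans ?_
  rw [Finset.card_product, ← Set.ncard_eq_toFinset_card _ hB.1]
  exact Nat.mul_le_mul (hL ▸ List.toFinset_card_le L) hB.2

section chain
variable {G : Type*} [Group G]

/-- The subgroup generators given by a certificate. -/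
def subGens (C : Cert) (g : ℕ → G) (i : ℕ) : G := match C.gens[i]? with
  | some (c, x, d) => rep C g c * letter g x * (rep C g d)⁻¹
  | none => 1

theorem subGens_of_le (C : Cert) (g : ℕ → G) {n : ℕ} (hn : C.gens.length = n) :
    ∀ i, n ≤ i → subGens C g i = 1 := by
  intro i hi
  have : C.gens[i]? = none := List.getElem?_eq_none (by omega)
  simp [subGens, this]

theorem check_subGens {C : Cert} {g : ℕ → G} {Q : List (ℕ × List ℕ × List ℕ)} {m : ℕ}
    (hc : check C Q m = true) (hg : ∀ i, C.ng ≤ i → g i = 1) (hrel : ∀ w ∈ C.rels, ev g w = 1) :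
    (∀ c w l, (c, w, l) ∈ Q → HasLab C (subGens C g) l (rep C g c * ev g w * (rep C g c)⁻¹)) ∧
    (m ≠ 0 → ∃ L : List ℕ, L.length = m ∧ ∀ z ∈ Subgroup.closure (Set.range g), ∃ a ∈ L,
        z * (rep C g a)⁻¹ ∈ Subgroup.closure (Set.range (subGens C g))) :=
  check_sound hc hg hrel (fun i c x d hi => by simp [subGens, hi])

theorem HasLab.eq {C : Cert} (hC : C.lab = true) {h : ℕ → G} {l : List ℕ} {z : G}
    (H : HasLab C h l z) : z = ev h l := by
  unfold HasLab at H
  rwa [hC] at H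

/-- Relators read off along closed paths. -/
theorem ev_label_eq_one {C : Cert} (hC : C.lab = true) {g : ℕ → G} {h : ℕ → G} {c : ℕ}
    {w l : List ℕ} (H : HasLab C h l (rep C g c * ev g w * (rep C g c)⁻¹)) (hw : ev g w = 1) :
    ev h l = 1 := by
  rw [← H.eq hC, hw]; group

/-- A relator conjugated by a representative is still 1, so the label of its closed path is a
relator of the subgroup. -/
theorem ev_mkQueries {C : Cert} (hC : C.lab = true) {g h : ℕ → G}
    {P : List (ℕ × List ℕ)} {R : List (List ℕ)} (hP : ∀ p ∈ P, ev g p.2 = 1)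
    (H : ∀ c w l, (c, w, l) ∈ mkQueries P R → HasLab C h l (rep C g c * ev g w * (rep C g c)⁻¹))
    (hlen : R.length ≤ P.length) : ∀ l ∈ R, ev h l = 1 := by
  intro l hl
  obtain ⟨i, hi, rfl⟩ := List.getElem_of_mem hl
  have hi' : i < P.length := by omega
  refine ev_label_eq_one hC (H P[i].1 P[i].2 R[i] ?_) (hP _ (List.getElem_mem hi'))
  refine List.mem_iff_getElem.2 ⟨i, by simp [mkQueries]; omega, by simp [mkQueries]⟩

/-- The word is a rotation of a relator or of the inverse of one. -/
def isConj (R : List (List ℕ)) (w : List ℕ) : Bool :=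
  R.any fun v => (List.range v.length).any fun k =>
    (v.drop k ++ v.take k == w) || ((invWord v).drop k ++ (invWord v).take k == w)

theorem ev_rotate {g : ℕ → G} {u : List ℕ} (hu : ev g u = 1) (k : ℕ) :
    ev g (u.drop k ++ u.take k) = 1 := by
  rw [← List.take_append_drop k u, ev_append] at hu
  rw [ev_append]
  exact mul_eq_one_comm.1 hu

theorem ev_of_isConj {g : ℕ → G} {R : List (List ℕ)} (hR : ∀ w ∈ R, ev g w = 1) {w : List ℕ}
    (hw : isConj R w = true) : ev g w = 1 := by
  simp only [isConj, List.any_eq_true, Bool.or_eq_true, beq_iff_eq] at hw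
  obtain ⟨v, hv, k, -, h | h⟩ := hw
  · rw [← h]; exact ev_rotate (hR v hv) k
  · rw [← h]; exact ev_rotate (by rw [ev_invWord, hR v hv, inv_one]) k

/-- Re-indexing of letters. -/
def reindex (f : ℕ → ℕ) (x : ℕ) : ℕ := 2 * f (x / 2) + x % 2

theorem ev_reindex (g : ℕ → G) (f : ℕ → ℕ) (w : List ℕ) :
    ev g (w.map (reindex f)) = ev (g ∘ f) w := by
  induction w with
  | nil => rfl
  | cons x w ih =>
    have h1 : reindex f x % 2 = x % 2 := by unfold reindex; omega
    have h2 : reindex f x / 2 = f (x / 2) := by unfold reindex; omega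
    simp [ih, letter, h1, h2]

/-- The generators of the subgroup of index 266 among those of the subgroup of index 57. -/
def idxH (j : ℕ) : ℕ := [3, 4, 5, 7].getD j 8

theorem isConj_pathsL : ∀ p ∈ pathsL.take 3, isConj certL.rels p.2 = true := by decide +kernel

theorem isConj_pathsJ : ∀ p ∈ pathsJ, isConj relsL p.2 = true := by decide +kernel

/-- The relators of `certC` are known words in the generators 3, 4, 5 and 7 only, renumbered by
`idxH`. -/
theorem relsC_mem : ∀ w ∈ certC.rels, w.map (reindex idxH) ∈ relsJ ++ [extraRel, extraRel2] := by
  decide +kernel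

theorem isConj_pathC : isConj certC.rels [1, 5, 5, 3, 1] = true := by decide +kernel

section bound
variable {g : ℕ → G}

theorem relsL_hold (hg : ∀ i, 4 ≤ i → g i = 1) (hrel : ∀ w ∈ certL.rels, ev g w = 1) :
    ∀ w ∈ relsL, ev (subGens certL g) w = 1 := by
  have H := (check_subGens certL_check hg hrel).1
  refine ev_mkQueries (C := certL) (g := g) rfl (P := pathsL.take 3) (R := relsL) ?_ (fun c w l hq => ?_) ?_
  · exact fun p hp => ev_of_isConj hrel (isConj_pathsL p hp)
  -- The first three queries come from relators of `W`; the last two describe generators of `L`.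
  · exact H c w l (List.mem_of_mem_take (i := 3) hq)
  · exact le_rfl

theorem label_three (hg : ∀ i, 4 ≤ i → g i = 1) (hrel : ∀ w ∈ certL.rels, ev g w = 1) :
    ev g [0, 2, 0, 2, 4, 6, 0] = ev (subGens certL g) [2, 0, 3, 3] := by
  have H := (check_subGens certL_check hg hrel).1 0 [0, 2, 0, 2, 4, 6, 0] [2, 0, 3, 3]
    (by decide +kernel)
  simpa [rep] using H.eq rfl

theorem label_four (hg : ∀ i, 4 ≤ i → g i = 1) (hrel : ∀ w ∈ certL.rels, ev g w = 1) :
    ev g [0, 2, 0, 6, 4, 6, 2] = ev (subGens certL g) [2, 0, 3, 0] := by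
  have H := (check_subGens certL_check hg hrel).1 0 [0, 2, 0, 6, 4, 6, 2] [2, 0, 3, 0]
    (by decide +kernel)
  simpa [rep] using H.eq rfl

/-- Each enumeration supplies the relators that the next one consumes: `x1`, ..., `x4` generate
successive subgroups, and the last is cyclic with 15th power 1. -/
theorem finite_closure_subGens
    (hg : ∀ i, 4 ≤ i → g i = 1) (hrel : ∀ w ∈ certL.rels, ev g w = 1) :
    (Subgroup.closure (Set.range (subGens certL g)) : Set G).Finite ∧
    (Subgroup.closure (Set.range (subGens certL g)) : Set G).ncard ≤ 57 * (266 * (132 * 15)) := by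
  set x1 := subGens certL g with hx1
  have r1 : ∀ w ∈ relsL, ev x1 w = 1 := relsL_hold hg hrel
  have g1 : ∀ i, 2 ≤ i → x1 i = 1 := subGens_of_le certL g rfl
  obtain ⟨HJ, cJ⟩ := check_subGens certJ_check g1 r1
  set x2 := subGens certJ x1 with hx2
  have g2 : ∀ i, 8 ≤ i → x2 i = 1 := subGens_of_le certJ x1 rfl
  have r2 : ∀ w ∈ relsJ, ev x2 w = 1 :=
    ev_mkQueries (C := certJ) rfl (P := pathsJ) (R := relsJ)
      (fun p hp => ev_of_isConj r1 (isConj_pathsJ p hp)) HJ le_rfl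
  have r3 : ev x2 extraRel = 1 := by
    have H := (check_subGens certRel_check g2 r2).1 0 extraRel [] (by simp)
    simpa [rep] using H.eq rfl
  have r2' : ∀ w ∈ relsJ ++ [extraRel], ev x2 w = 1 := by
    intro w hw
    rcases List.mem_append.1 hw with hw | hw
    · exact r2 w hw
    · rw [List.mem_singleton.1 hw]; exact r3
  have r4 : ev x2 extraRel2 = 1 := by
    have H := (check_subGens certRel2_check g2 r2').1 0 extraRel2 [] (by simp)
    simpa [rep] using H.eq rfl
  have r5 : ∀ w ∈ relsJ ++ [extraRel, extraRel2], ev x2 w = 1 := by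
    intro w hw
    rcases List.mem_append.1 hw with hw | hw
    · exact r2 w hw
    · simp only [List.mem_cons, List.not_mem_nil, or_false] at hw
      rcases hw with rfl | rfl
      · exact r3
      · exact r4
  have cH := (check_subGens certH_check g2 r5).2
  set x3 := subGens certH x2 with hx3
  -- The generating edges of `certH` are loops at the coset 0, whose representative is 1, so they
  -- are generators of the larger group itself.
  have e3 : x3 = x2 ∘ idxH := by
    funext i
    rcases lt_or_ge i 4 with hi | hi
    · interval_cases i <;> simp [hx3, subGens, certH, rep, letter, idxH]
    · rw [hx3, subGens_of_le certH x2 (n := 4) rfl i hi]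
      -- The default index 8 points just past the eight generators, where `x2` is 1.
      have : idxH i = 8 := by
        unfold idxH
        rw [List.getD_eq_default _ _ (by simpa using hi)]
      simp [this, g2]
  have g3 : ∀ i, 4 ≤ i → x3 i = 1 := subGens_of_le certH x2 rfl
  have r6 : ∀ w ∈ certC.rels, ev x3 w = 1 := by
    intro w hw
    rw [e3, ← ev_reindex]
    exact r5 _ (relsC_mem w hw)
  obtain ⟨HC, cC⟩ := check_subGens certC_check g3 r6
  set x4 := subGens certC x3 with hx4
  have g4 : ∀ i, 1 ≤ i → x4 i = 1 := subGens_of_le certC x3 rfl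
  have r7 : x4 0 ^ 15 = 1 := by
    have H := HC _ _ _ (List.mem_singleton.2 rfl)
    have := ev_label_eq_one (C := certC) rfl H (ev_of_isConj r6 isConj_pathC)
    simpa [letter, pow_succ, mul_assoc] using this
  have hcyc : Subgroup.closure (Set.range x4) = Subgroup.zpowers (x4 0) := by
    rw [Subgroup.zpowers_eq_closure]
    apply le_antisymm
    · rw [Subgroup.closure_le]
      rintro _ ⟨i, rfl⟩
      rcases Nat.eq_zero_or_pos i with rfl | hi
      · exact Subgroup.subset_closure rfl
      · rw [g4 i hi]; exact one_mem _
    · exact Subgroup.closure_mono (by rintro _ rfl; exact ⟨0, rfl⟩)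
  have f4 : (Subgroup.closure (Set.range x4) : Set G).Finite ∧
      (Subgroup.closure (Set.range x4) : Set G).ncard ≤ 15 := by
    rw [hcyc]
    have hfin : IsOfFinOrder (x4 0) := isOfFinOrder_iff_pow_eq_one.2 ⟨15, by norm_num, r7⟩
    refine ⟨(finite_zpowers).2 hfin, ?_⟩
    have : (Subgroup.zpowers (x4 0) : Set G).ncard = orderOf (x4 0) := by
      rw [← Nat.card_zpowers]; rfl
    rw [this]
    exact Nat.le_of_dvd (by norm_num) (orderOf_dvd_of_pow_eq_one r7)
  obtain ⟨L3, l3, c3⟩ := cC (by norm_num)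
  obtain ⟨L2, l2, c2⟩ := cH (by norm_num)
  obtain ⟨L1, l1, c1⟩ := cJ (by norm_num)
  exact finite_of_cover _ L1 l1 c1 (finite_of_cover _ L2 l2 c2 (finite_of_cover _ L3 l3 c3 f4))

end bound
end chain
/-! ## Products of matrices over `ZMod p`, encoded by natural numbers -/

/-- The entries of the `n × n` matrix with the given code. -/
def entry (n p c i j : ℕ) : ℕ := c / p ^ (n * i + j) % p

/-- The matrix with the given code. -/
def codeMat (n p c : ℕ) : Matrix (Fin n) (Fin n) (ZMod p) := fun i j => (entry n p c i j : ZMod p)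

/-- Entry of a product. -/
def prodEntry (n p a b i j : ℕ) : ℕ → ℕ
  | 0 => 0
  | k + 1 => prodEntry n p a b i j k + entry n p a i k * entry n p b k j

/-- Check of a product. -/
def prodOK (n p a b c : ℕ) : Bool := (List.range n).all fun i => (List.range n).all fun j =>
  Nat.beq (prodEntry n p a b i j n % p) (entry n p c i j)

theorem prodEntry_eq (n p a b i j m : ℕ) :
    prodEntry n p a b i j m = ∑ k ∈ Finset.range m, entry n p a i k * entry n p b k j := by
  induction m with
  | zero => rfl
  | succ m ih => rw [Finset.sum_range_succ, prodEntry, ih]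

theorem codeMat_mul {n p a b c : ℕ} (h : prodOK n p a b c = true) :
    codeMat n p a * codeMat n p b = codeMat n p c := by
  ext i j
  simp only [prodOK, List.all_eq_true, List.mem_range] at h
  have hij := Nat.eq_of_beq_eq_true (h i i.2 j j.2)
  rw [Matrix.mul_apply]
  unfold codeMat
  rw [← hij, ZMod.natCast_mod, prodEntry_eq, ← Fin.sum_univ_eq_sum_range
    (fun k => entry n p a i k * entry n p b k j)]
  push_cast
  rfl

/-- The code of the product matrix. -/
def mulCode (n p a b : ℕ) : ℕ :=
  (List.range (n * n)).foldr (fun k acc => prodEntry n p a b (k / n) (k % n) n % p + p * acc) 0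

/-- The code of a product of matrices with the given codes, times the matrix with the code `c`.
The value `0` signals a failed check. -/
def wordCode (n p : ℕ) (f : ℕ → ℕ) : ℕ → List ℕ → ℕ
  | c, [] => c
  | c, x :: t => match mulCode n p c (f x) with
    | 0 => 0
    -- `mulCode` only proposes the product; `prodOK` verifies every entry.
    | d + 1 => match prodOK n p c (f x) (d + 1) with
      | true => wordCode n p f (d + 1) t
      | false => 0

theorem codeMat_word {n p : ℕ} {f : ℕ → ℕ} : ∀ {t : List ℕ} {c : ℕ},
    wordCode n p f c t ≠ 0 →
    codeMat n p c * (t.map fun q => codeMat n p (f q)).prod = codeMat n p (wordCode n p f c t)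
  | [], c, _ => by simp [wordCode]
  | x :: t, c, h => by
    unfold wordCode at h ⊢
    cases hd : mulCode n p c (f x) with
    | zero => simp [hd] at h
    | succ d =>
      cases hp : prodOK n p c (f x) (d + 1) with
      | false => simp [hd, hp] at h
      | true =>
        simp only [hd, hp] at h ⊢
        rw [List.map_cons, List.prod_cons, ← mul_assoc, codeMat_mul hp, codeMat_word h]

/-- Check that two codes give different matrices. -/
def neOK (n p a b : ℕ) : Bool := (List.range n).any fun i => (List.range n).any fun j =>
  !(Nat.beq (entry n p a i j) (entry n p b i j))

theorem codeMat_ne {n p a b : ℕ} [NeZero p] (h : neOK n p a b = true) :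
    codeMat n p a ≠ codeMat n p b := by
  intro he
  simp only [neOK, List.any_eq_true, List.mem_range] at h
  obtain ⟨i, hi, j, hj, hij⟩ := h
  have h1 := congrFun (congrFun he ⟨i, hi⟩) ⟨j, hj⟩
  unfold codeMat at h1
  rw [ZMod.natCast_eq_natCast_iff', entry, entry, Nat.mod_mod, Nat.mod_mod] at h1
  rw [entry, entry] at hij
  simp only [h1] at hij
  simp at hij

/-- Check that the word gives the matrix with the code `e`. -/
def wordEq (n p : ℕ) (f : ℕ → ℕ) (c : ℕ) (t : List ℕ) (e : ℕ) : Bool :=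
  match wordCode n p f c t with
  | 0 => false
  | d + 1 => Nat.beq (d + 1) e

/-- Check that the word does not give the matrix with the code `e`. -/
def wordNe (n p : ℕ) (f : ℕ → ℕ) (c : ℕ) (t : List ℕ) (e : ℕ) : Bool :=
  match wordCode n p f c t with
  | 0 => false
  | d + 1 => neOK n p (d + 1) e

theorem codeMat_wordEq {n p : ℕ} {f : ℕ → ℕ} {t : List ℕ} {c e : ℕ}
    (h : wordEq n p f c t e = true) :
    codeMat n p c * (t.map fun q => codeMat n p (f q)).prod = codeMat n p e := by
  unfold wordEq at h
  split at h
  · simp at h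
  · rename_i d hd
    rw [codeMat_word (by rw [hd]; exact Nat.succ_ne_zero d), hd, ← Nat.eq_of_beq_eq_true h]

theorem codeMat_wordNe {n p : ℕ} [NeZero p] {f : ℕ → ℕ} {t : List ℕ} {c e : ℕ}
    (h : wordNe n p f c t e = true) :
    codeMat n p c * (t.map fun q => codeMat n p (f q)).prod ≠ codeMat n p e := by
  unfold wordNe at h
  split at h
  · simp at h
  · rename_i d hd
    rw [codeMat_word (by rw [hd]; exact Nat.succ_ne_zero d), hd]
    exact codeMat_ne h

end CosetCert

/-! ### Relations in `W` and maps out of it -/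

namespace Polytope535
open CosetCert

theorem s_sq (i : Fin 4) : s i * s i = 1 := by
  rw [← pow_two]
  apply PresentedGroup.one_of_mem
  fin_cases i <;> simp [relators]

theorem s01 : (s 0 * s 1) ^ 5 = 1 :=
  PresentedGroup.one_of_mem (rels := relators) (x := (FreeGroup.of 0 * FreeGroup.of 1) ^ 5)
    (by simp [relators])

theorem s12 : (s 1 * s 2) ^ 3 = 1 :=
  PresentedGroup.one_of_mem (rels := relators) (x := (FreeGroup.of 1 * FreeGroup.of 2) ^ 3)
    (by simp [relators])

theorem s23 : (s 2 * s 3) ^ 5 = 1 :=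
  PresentedGroup.one_of_mem (rels := relators) (x := (FreeGroup.of 2 * FreeGroup.of 3) ^ 5)
    (by simp [relators])

theorem s123 : (s 1 * s 2 * s 3) ^ 5 = 1 :=
  PresentedGroup.one_of_mem (rels := relators)
    (x := (FreeGroup.of 1 * FreeGroup.of 2 * FreeGroup.of 3) ^ 5) (by simp [relators])

theorem s02 : s 0 * s 2 = s 2 * s 0 := mul_inv_eq_one.1 <|
  PresentedGroup.one_of_mem (rels := relators) (x := FreeGroup.of 0 * FreeGroup.of 2 *
    (FreeGroup.of 2 * FreeGroup.of 0)⁻¹) (by simp [relators])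

theorem s13 : s 1 * s 3 = s 3 * s 1 := mul_inv_eq_one.1 <|
  PresentedGroup.one_of_mem (rels := relators) (x := FreeGroup.of 1 * FreeGroup.of 3 *
    (FreeGroup.of 3 * FreeGroup.of 1)⁻¹) (by simp [relators])

theorem s03 : s 0 * s 3 = s 3 * s 0 := mul_inv_eq_one.1 <|
  PresentedGroup.one_of_mem (rels := relators) (x := FreeGroup.of 0 * FreeGroup.of 3 *
    (FreeGroup.of 3 * FreeGroup.of 0)⁻¹) (by simp [relators])

theorem closure_s : Subgroup.closure (Set.range s) = ⊤ := PresentedGroup.closure_range_of relators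

/-- Relators of `W` as words. -/
def relWords : List (List ℕ) :=
  [[0, 0], [1, 1], [2, 2], [3, 3], [0, 1, 0, 1, 0, 1, 0, 1, 0, 1], [1, 2, 1, 2, 1, 2],
    [2, 3, 2, 3, 2, 3, 2, 3, 2, 3], [0, 2, 0, 2], [1, 3, 1, 3], [0, 3, 0, 3],
    [1, 2, 3, 1, 2, 3, 1, 2, 3, 1, 2, 3, 1, 2, 3]]

/-- Homomorphisms from `W`. -/
theorem exists_hom {G : Type*} [Group G] (v : ℕ → G)
    (hv : ∀ w ∈ relWords, (w.map v).prod = 1) : ∃ φ : W →* G, ∀ i : Fin 4, φ (s i) = v i := by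
  -- `relWords` records commuting generators as abab = 1, which for involutions is the commutator
  -- relation.
  have comm : ∀ a b : G, a * a = 1 → b * b = 1 → a * b * a * b = 1 → a * b * (b * a)⁻¹ = 1 := by
    intro a b ha hb hab
    rw [mul_inv_rev, inv_eq_of_mul_eq_one_right ha, inv_eq_of_mul_eq_one_right hb, ← mul_assoc, hab]
  simp only [relWords, List.forall_mem_cons, List.map_cons, List.map_nil, List.prod_cons,
    List.prod_nil, mul_one] at hv
  obtain ⟨h0, h1, h2, h3, h4, h5, h6, h7, h8, h9, h10, -⟩ := hv
  have hr : ∀ r ∈ relators, FreeGroup.lift (fun i : Fin 4 => v i) r = 1 := by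
    intro r hr
    simp only [relators, Set.mem_insert_iff, Set.mem_singleton_iff] at hr
    rcases hr with rfl | rfl | rfl | rfl | rfl | rfl | rfl | rfl | rfl | rfl | rfl
    · simpa [pow_two] using h0
    · simpa [pow_two] using h1
    · simpa [pow_two] using h2
    · simpa [pow_two] using h3
    · simpa [pow_succ, mul_assoc] using h4
    · simpa [pow_succ, mul_assoc] using h5
    · simpa [pow_succ, mul_assoc] using h6
    · simpa using comm _ _ h0 h2 (by simpa [mul_assoc] using h7)
    · simpa using comm _ _ h1 h3 (by simpa [mul_assoc] using h8)
    · simpa using comm _ _ h0 h3 (by simpa [mul_assoc] using h9)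
    · simpa [pow_succ, mul_assoc] using h10
  exact ⟨PresentedGroup.toGroup hr, fun i => by simp [s]⟩

end Polytope535

/-! ### Elementary abelian 2-subgroups -/

namespace CosetCert

/-- Commuting involutions generate a group of order $2^n$; more than $2^k$ distinct elements force
$n>k$, so a full list is not needed. -/
theorem two_pow_dvd_card {G : Type*} [Group G] [Finite G] {S : Set G}
    (hS : ∀ x ∈ S, ∀ y ∈ S, x * y = y * x) (h2 : ∀ x ∈ S, x * x = 1) (l : List G)
    (hl : l.Nodup) (hlS : ∀ x ∈ l, x ∈ Subgroup.closure S) {k : ℕ} (hk : 2 ^ k < l.length) :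
    2 ^ (k + 1) ∣ Nat.card G := by
  classical
  have := Subgroup.isMulCommutative_closure hS
  have hcomm : ∀ x ∈ Subgroup.closure S, ∀ y ∈ Subgroup.closure S, x * y = y * x := by
    intro x hx y hy
    exact congrArg Subtype.val (mul_comm' (⟨x, hx⟩ : Subgroup.closure S) ⟨y, hy⟩)
  have hsq : ∀ x ∈ Subgroup.closure S, x * x = 1 := by
    intro x hx
    induction hx using Subgroup.closure_induction with
    | mem x hx => exact h2 x hx
    | one => simp
    | mul x y hx hy ihx ihy =>
      rw [show x * y * (x * y) = x * (y * x) * y by group, hcomm y hy x hx,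
        show x * (x * y) * y = (x * x) * (y * y) by group, ihx, ihy, one_mul]
    | inv x hx ih => rw [← mul_inv_rev, ih, inv_one]
  have hp : IsPGroup 2 (Subgroup.closure S) := fun x => ⟨1, by
    rw [pow_one, pow_two]; exact Subtype.ext (hsq x x.2)⟩
  obtain ⟨n, hn⟩ := IsPGroup.iff_card.1 hp
  have hle : l.length ≤ Nat.card (Subgroup.closure S) := by
    rw [← List.toFinset_card_of_nodup hl]
    have : (l.toFinset : Set G) ⊆ (Subgroup.closure S : Set G) := by
      intro x hx
      exact hlS x (by simpa using hx)
    rw [← Set.ncard_coe_finset]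
    exact (Set.ncard_le_ncard this (Set.toFinite _))
  have hkn : k + 1 ≤ n := by
    by_contra hlt
    have : 2 ^ n ≤ 2 ^ k := Nat.pow_le_pow_right (by norm_num) (by omega)
    omega
  refine (pow_dvd_pow 2 hkn).trans ?_
  rw [← hn]
  exact Subgroup.card_subgroup_dvd_card _

end CosetCert

/-! ### The quotient $J_1$ -/

namespace Polytope535
open CosetCert

/-- Codes of matrices: images of the generators of `W`, then `Y`, `Z`, their inverses, and `1`. -/
def codeJ (x : ℕ) : ℕ := [
  0x166696f6d58b9c4360c71e3364910053007d56a69fa,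
  0x136bca70fd2d9769e83c221051d26244834fc0cad62,
  0x15208be38cbeba98449b8cc69ab145b878a5382d566,
  0x130ca7d4756a817341da1fc1c448af6887e82f6e32d,
  0x2adce98fa512beaecd2d9b482e65bd7faef7b,
  0x55206e70dfd1352cf717bafc5a7b39012b5d5155e9,
  0x608e3343493ebd7ce2bf5c09bde60789fe3703a9b,
  0x5a7b432d8a22274bf0a7059156ea27670be91930e1,
  0x4261c33e425b2245dbe38f46b28e252edec4a92ae7].getD x 0

theorem codeJ_one : codeMat 7 11 (codeJ 8) = 1 := by decide +kernel

/-- The matrices in `codeJ` for the generators of `W` are involutions. -/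
theorem codeJ_sq (i : Fin 4) :
    codeMat 7 11 (codeJ i) * codeMat 7 11 (codeJ i) = 1 := by
  have h2 : ∀ i : Fin 4, prodOK 7 11 (codeJ i) (codeJ i) (codeJ 8) = true := by decide +kernel
  rw [codeMat_mul (h2 i), codeJ_one]

/-- Images of the generators of `W`, then Janko's generators and their inverses. -/
noncomputable def genJ (x : ℕ) : GL (Fin 7) (ZMod 11) :=
  if h : x < 4 then ⟨codeMat 7 11 (codeJ x), codeMat 7 11 (codeJ x), codeJ_sq ⟨x, h⟩, codeJ_sq ⟨x, h⟩⟩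
  else if x = 4 then jankoY else if x = 5 then jankoZ else if x = 6 then jankoY⁻¹
  else if x = 7 then jankoZ⁻¹ else 1

theorem genJ_val {x : ℕ} (hx : x ≤ 8) : (genJ x).val = codeMat 7 11 (codeJ x) := by
  rcases lt_or_ge x 4 with h | h
  · simp [genJ, h]
  · have h4 : jankoY.val = codeMat 7 11 (codeJ 4) := by decide +kernel
    have h5 : jankoZ.val = codeMat 7 11 (codeJ 5) := by decide +kernel
    have h6 : jankoY.inv = codeMat 7 11 (codeJ 6) := by decide +kernel
    have h7 : jankoZ.inv = codeMat 7 11 (codeJ 7) := by decide +kernel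
    have h8 : (1 : Matrix (Fin 7) (Fin 7) (ZMod 11)) = codeMat 7 11 (codeJ 8) := by decide +kernel
    interval_cases x
    · exact h4
    · exact h5
    · exact h6
    · exact h7
    · exact h8

theorem genJ_word {t : List ℕ} (hl : t.all (Nat.ble · 8) = true) :
    (t.map genJ).prod.val = codeMat 7 11 (codeJ 8) * (t.map fun q => codeMat 7 11 (codeJ q)).prod := by
  rw [codeJ_one, one_mul]
  simp only [List.all_eq_true, Nat.ble_eq] at hl
  induction t with
  | nil => rfl
  | cons x t ih =>
    rw [List.map_cons, List.prod_cons, List.map_cons, List.prod_cons, Units.val_mul,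
      ih fun y hy => hl y (by simp [hy]), genJ_val (hl x (by simp))]

/-- Check that a word in the matrices `genJ` is trivial. -/
def isOneJ (t : List ℕ) : Bool :=
  t.all (Nat.ble · 8) && wordEq 7 11 codeJ (codeJ 8) t (codeJ 8)

/-- Check that a word in the matrices `genJ` is not trivial. -/
def neOneJ (t : List ℕ) : Bool :=
  t.all (Nat.ble · 8) && wordNe 7 11 codeJ (codeJ 8) t (codeJ 8)

theorem genJ_eq_one {t : List ℕ} (ht : isOneJ t = true) : (t.map genJ).prod = 1 := by
  simp only [isOneJ, Bool.and_eq_true] at ht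
  apply Units.ext
  rw [genJ_word ht.1, codeMat_wordEq ht.2, codeJ_one]; rfl

theorem genJ_ne_one {t : List ℕ} (ht : neOneJ t = true) : (t.map genJ).prod ≠ 1 := by
  simp only [neOneJ, Bool.and_eq_true] at ht
  intro h
  refine codeMat_wordNe ht.2 ?_
  rw [← genJ_word ht.1, h, codeJ_one]; rfl

/-- A word for `Y` in the generators of `W`. -/
def wordY : List ℕ := [0, 2, 3, 2, 1, 0, 1, 0, 3, 2, 1, 0, 1, 2, 3, 2, 1, 0]

/-- A word for `Z` in the generators of `W`. -/
def wordZ : List ℕ := [0, 2, 1, 0, 1, 0, 2, 1, 0, 1, 3, 2, 1, 0, 1, 0, 2, 3, 2, 1, 0, 1, 0, 2]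

/-- Trivial words that express the images of the generators of `W` by `Y` and `Z`. -/
def wordsYZ : List (List ℕ) := [[0, 4, 7, 4, 5], [1, 5, 5, 4, 4, 5, 4, 5, 6, 5, 5], [2, 6, 7, 6, 5], [3, 4, 5, 4, 5, 4, 4, 7, 7, 4, 4, 7, 6]]

/-- Words for `Y` and `Z` in the images of the generators of `W`. -/
theorem genJ_relations :
    relWords.all isOneJ = true ∧
    isOneJ ([6] ++ wordY) = true ∧ isOneJ ([7] ++ wordZ) = true ∧
    wordsYZ.all isOneJ = true := by decide +kernel

/-- Repeat a word. -/
def rpt (n : ℕ) (t : List ℕ) : List ℕ := (List.replicate n t).flatten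

theorem prod_rpt {G : Type*} [Group G] (v : ℕ → G) (n : ℕ) (t : List ℕ) :
    ((rpt n t).map v).prod = (t.map v).prod ^ n := by
  induction n with
  | zero => simp [rpt]
  | succ n ih =>
    have : rpt (n + 1) t = t ++ rpt n t := by simp [rpt, List.replicate_succ]
    rw [this, List.map_append, List.prod_append, ih, pow_succ']

theorem prime_dvd_card {G : Type*} [Group G] {v : ℕ → G} {p : ℕ} [Fact p.Prime] {t : List ℕ}
    (h1 : ((rpt p t).map v).prod = 1) (h2 : (t.map v).prod ≠ 1) : p ∣ Nat.card G := by
  rw [prod_rpt] at h1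
  rw [← orderOf_eq_prime h1 h2]
  exact orderOf_dvd_natCard _

theorem genJ_mem (x : ℕ) : genJ x ∈ J1 := by
  have hY : jankoY ∈ J1 := Subgroup.subset_closure (by simp)
  have hZ : jankoZ ∈ J1 := Subgroup.subset_closure (by simp)
  -- A trivial word with first letter `i` and the others among `Y`, `Z`, their inverses and 1
  -- expresses `genJ i` in $J_1$.
  have key : ∀ (i : ℕ) (t : List ℕ), (∀ x ∈ t, 4 ≤ x) → ((i :: t).map genJ).prod = 1 →
      genJ i ∈ J1 := by
    intro i t ht h
    rw [List.map_cons, List.prod_cons] at h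
    rw [eq_inv_of_mul_eq_one_left h]
    apply inv_mem
    apply Subgroup.list_prod_mem
    intro z hz
    obtain ⟨x, hx, rfl⟩ := List.mem_map.1 hz
    have := ht x hx
    unfold genJ
    rw [dif_neg (by omega)]
    split_ifs
    exacts [hY, hZ, inv_mem hY, inv_mem hZ, one_mem _]
  have hw : ∀ w ∈ wordsYZ, (w.map genJ).prod = 1 := fun w hw =>
    genJ_eq_one (List.all_eq_true.1 genJ_relations.2.2.2 w hw)
  by_cases hx : x < 4
  · have h4 : ∀ w ∈ wordsYZ, ∀ y ∈ w.tail, 4 ≤ y := by decide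
    have h5 : ∀ y < 4, ∃ w ∈ wordsYZ, y :: w.tail = w := by decide
    obtain ⟨w, hwm, hwx⟩ := h5 x hx
    exact key x w.tail (h4 w hwm) (by rw [hwx]; exact hw w hwm)
  · unfold genJ
    rw [dif_neg hx]
    split_ifs
    exacts [hY, hZ, inv_mem hY, inv_mem hZ, one_mem _]

/-- The elements of `J₁` given by `genJ`. -/
noncomputable def genJ' (x : ℕ) : J1 := ⟨genJ x, genJ_mem x⟩

theorem genJ'_prod (t : List ℕ) : ((t.map genJ').prod : GL (Fin 7) (ZMod 11)) =
    (t.map genJ).prod := by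
  rw [← Subgroup.coe_subtype, map_list_prod, List.map_map]
  rfl

theorem genJ'_eq_one {t : List ℕ} (ht : isOneJ t = true) : (t.map genJ').prod = 1 :=
  Subtype.ext (by rw [genJ'_prod, genJ_eq_one ht]; rfl)

theorem genJ'_ne_one {t : List ℕ} (ht : neOneJ t = true) : (t.map genJ').prod ≠ 1 := by
  intro h
  apply genJ_ne_one ht
  rw [← genJ'_prod, h]; rfl

/-- A word for `ω`. -/
def wordOmega : List ℕ := rpt 5 [0, 1, 2]

theorem commute_of_sq {G : Type*} [Group G] {a b : G} (ha : a * a = 1) (hb : b * b = 1)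
    (hab : (a * b) ^ 2 = 1) : a * b = b * a := by
  rw [pow_two] at hab
  rw [eq_inv_of_mul_eq_one_left hab, mul_inv_rev, inv_eq_of_mul_eq_one_right ha,
    inv_eq_of_mul_eq_one_right hb]

theorem ne_of_mul_ne_one {G : Type*} [Group G] {a b : G} (ha : a * a = 1) (hab : a * b ≠ 1) :
    a ≠ b := by
  rintro rfl; exact hab ha

/-- The five distinct elements 1, a, b, c, ab exceed 4, which suffices for `two_pow_dvd_card`. -/
theorem eight_dvd_card {G : Type*} [Group G] [Finite G] {a b c : G} (ha : a * a = 1)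
    (hb : b * b = 1) (hc : c * c = 1) (hab : (a * b) ^ 2 = 1) (hac : (a * c) ^ 2 = 1)
    (hbc : (b * c) ^ 2 = 1) (na : a ≠ 1) (nb : b ≠ 1) (nc : c ≠ 1) (nab : a * b ≠ 1)
    (nac : a * c ≠ 1) (nbc : b * c ≠ 1) (nabc : a * (b * c) ≠ 1) : 8 ∣ Nat.card G := by
  have cab := commute_of_sq ha hb hab
  have cac := commute_of_sq ha hc hac
  have cbc := commute_of_sq hb hc hbc
  have ma : a ∈ Subgroup.closure {a, b, c} := Subgroup.subset_closure (by simp)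
  have mb : b ∈ Subgroup.closure {a, b, c} := Subgroup.subset_closure (by simp)
  have mc : c ∈ Subgroup.closure {a, b, c} := Subgroup.subset_closure (by simp)
  refine two_pow_dvd_card (S := {a, b, c}) (k := 2) ?_ ?_ [1, a, b, c, a * b] ?_ ?_ (by simp)
  · simp only [Set.mem_insert_iff, Set.mem_singleton_iff]
    rintro x (rfl | rfl | rfl) y (rfl | rfl | rfl) <;> first | rfl | assumption | (symm; assumption)
  · simp only [Set.mem_insert_iff, Set.mem_singleton_iff]
    rintro x (rfl | rfl | rfl) <;> assumption
  · have h1 := ne_of_mul_ne_one ha nab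
    have h2 := ne_of_mul_ne_one ha nac
    have h3 := ne_of_mul_ne_one hb nbc
    have h4 : a ≠ a * b := by simpa using nb
    have h5 : b ≠ a * b := by simpa using na
    have h6 : c ≠ a * b := by
      intro h
      apply nabc
      rw [← mul_assoc, ← h, hc]
    simp [na.symm, nb.symm, nc.symm, nab.symm, h1, h2, h3, h4, h5, h6]
  · simp only [List.mem_cons, List.not_mem_nil, or_false]
    rintro x (rfl | rfl | rfl | rfl | rfl)
    exacts [one_mem _, ma, mb, mc, mul_mem ma mb]

/-- The homomorphism from `W` onto `J₁`. -/
theorem exists_hom_J1 : ∃ φ : W →* J1, Function.Surjective φ ∧ φ (nu ^ 3) = 1 := by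
  obtain ⟨φ, hφ⟩ := exists_hom genJ' (fun w hw => genJ'_eq_one
    (List.all_eq_true.1 genJ_relations.1 w hw))
  refine ⟨φ, ?_, ?_⟩
  · have hmem : ∀ x < 4, (genJ' x : GL (Fin 7) (ZMod 11)) ∈ φ.range.map J1.subtype := by
      intro x hx
      exact ⟨genJ' x, ⟨s ⟨x, hx⟩, hφ ⟨x, hx⟩⟩, rfl⟩
    -- Used for `i` = 6 and 7, the inverses of `Y` and `Z`: triviality of $Y^{-1}w$ says that $Y$ is
    -- the word $w$ in the images of the generators of `W`.
    have hword : ∀ (i : ℕ) (t : List ℕ), (∀ x ∈ t, x < 4) → isOneJ ([i] ++ t) = true →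
        (genJ i)⁻¹ ∈ φ.range.map J1.subtype := by
      intro i t ht h
      have h1 := genJ_eq_one h
      rw [List.map_append, List.prod_append, List.map_singleton, List.prod_singleton] at h1
      rw [← eq_inv_of_mul_eq_one_right h1]
      apply Subgroup.list_prod_mem
      intro z hz
      obtain ⟨x, hx, rfl⟩ := List.mem_map.1 hz
      exact hmem x (ht x hx)
    have hJ : J1 ≤ φ.range.map J1.subtype := by
      refine (Subgroup.closure_le _).2 ?_
      rintro x (rfl | rfl)
      · have e : (genJ 6)⁻¹ = jankoY := by simp [genJ]
        rw [← e]; exact hword 6 wordY (by decide) genJ_relations.2.1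
      · have e : (genJ 7)⁻¹ = jankoZ := by simp [genJ]
        rw [← e]; exact hword 7 wordZ (by decide) genJ_relations.2.2.1
    rintro ⟨x, hx⟩
    obtain ⟨y, ⟨w, hw⟩, hy⟩ := hJ hx
    exact ⟨w, by rw [hw]; exact Subtype.ext hy⟩
  · have h1 := genJ'_eq_one (t := rpt 3 (wordOmega ++ [3])) (by decide +kernel)
    rw [prod_rpt, List.map_append, List.prod_append, wordOmega, prod_rpt] at h1
    have e0 := hφ 0
    have e1 := hφ 1
    have e2 := hφ 2
    have e3 := hφ 3
    simp only [nu, omega, map_pow, map_mul, e0, e1, e2, e3]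
    simpa [mul_assoc] using h1

theorem prime_dvd_card_J1 {p : ℕ} [Fact p.Prime] {t : List ℕ}
    (h : (isOneJ (rpt p t) && neOneJ t) = true) : p ∣ Nat.card J1 := by
  rw [Bool.and_eq_true] at h
  exact prime_dvd_card (genJ'_eq_one h.1) (genJ'_ne_one h.2)

theorem eight_dvd_card_J1 [Finite J1] (A B C : List ℕ)
    (h1 : [A, B, C, A ++ B, A ++ C, B ++ C].all (fun t => isOneJ (rpt 2 t)) = true)
    (h2 : [A, B, C, A ++ B, A ++ C, B ++ C, A ++ (B ++ C)].all neOneJ = true) :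
    8 ∣ Nat.card J1 := by
  have sq : ∀ t, isOneJ (rpt 2 t) = true → (t.map genJ').prod ^ 2 = 1 := fun t ht => by
    rw [← prod_rpt]; exact genJ'_eq_one ht
  rw [List.all_eq_true] at h1 h2
  have q := fun t ht => sq t (h1 t ht)
  have n := fun t ht => genJ'_ne_one (h2 t ht)
  simp only [List.forall_mem_cons, List.map_append, List.prod_append] at q n
  obtain ⟨qa, qb, qc, qab, qac, qbc, -⟩ := q
  obtain ⟨na, nb, nc, nab, nac, nbc, nabc, -⟩ := n
  rw [pow_two] at qa qb qc
  exact eight_dvd_card qa qb qc qab qac qbc na nb nc nab nac nbc nabc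

theorem dvd_card_J1 [Finite J1] : 175560 ∣ Nat.card J1 := by
  have : Fact (Nat.Prime 7) := ⟨by norm_num⟩
  have : Fact (Nat.Prime 11) := ⟨by norm_num⟩
  have : Fact (Nat.Prime 19) := ⟨by norm_num⟩
  have : Fact (Nat.Prime 5) := ⟨by norm_num⟩
  have d3 := prime_dvd_card_J1 (p := 3) (t := [1, 2]) (by decide +kernel)
  have d5 := prime_dvd_card_J1 (p := 5) (t := [0, 1]) (by decide +kernel)
  have d7 := prime_dvd_card_J1 (p := 7) (t := [4]) (by decide +kernel)
  have d11 := prime_dvd_card_J1 (p := 11) (t := [0, 1, 0, 1, 2, 3]) (by decide +kernel)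
  have d19 := prime_dvd_card_J1 (p := 19) (t := [0, 1, 2, 1, 3]) (by decide +kernel)
  -- The images of $s_0$, $s_2$ and $\omega$; in the dodecahedral group $\langle s_0,s_1,s_2\rangle$
  -- the element $\omega$ is central.
  have d8 := eight_dvd_card_J1 [0] [2] wordOmega (by decide +kernel) (by decide +kernel)
  have h : Nat.Coprime 3 5 ∧ Nat.Coprime (3 * 5) 7 ∧ Nat.Coprime (3 * 5 * 7) 8 ∧
    Nat.Coprime (3 * 5 * 7 * 8) 11 ∧ Nat.Coprime (3 * 5 * 7 * 8 * 11) 19 := by norm_num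
  obtain ⟨h1, h2, h3, h4, h5⟩ := h
  have d := h5.mul_dvd_of_dvd_of_dvd (h4.mul_dvd_of_dvd_of_dvd (h3.mul_dvd_of_dvd_of_dvd
    (h2.mul_dvd_of_dvd_of_dvd (h1.mul_dvd_of_dvd_of_dvd d3 d5) d7) d8) d11) d19
  exact (show 175560 = 3 * 5 * 7 * 8 * 11 * 19 by norm_num) ▸ d

/-! ### The quotient $L_2(19)$ -/

/-- Codes of matrices in `SL₂(𝔽₁₉)` for the images of the generators of `W`. -/
def codeP (x : ℕ) : ℕ := [6517, 114592, 125743, 89553].getD x 6860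

/-- In base 19 the identity has the code 1 + 19³ = 6860, and its negative 18 · 6860 = 123480. -/
theorem codeP_one : codeMat 2 19 6860 = 1 := by decide +kernel

theorem codeP_neg_one : codeMat 2 19 123480 = -1 := by decide +kernel

theorem codeP_det (x : ℕ) : (codeMat 2 19 (codeP x)).det = 1 := by
  rcases lt_or_ge x 4 with h | h
  · have : ∀ x < 4, (codeMat 2 19 (codeP x)).det = 1 := by
      simp only [Matrix.det_fin_two]
      decide +kernel
    exact this x h
  · have : codeP x = 6860 := by
      unfold codeP
      rw [List.getD_eq_default _ _ (by simpa using h)]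
    rw [this, codeP_one, Matrix.det_one]

/-- Matrices in `SL₂(𝔽₁₉)` for the images of the generators of `W`. -/
noncomputable def genS (x : ℕ) : SL(2, ZMod 19) := ⟨codeMat 2 19 (codeP x), codeP_det x⟩

/-- Images of the generators of `W` in `L₂(19)`. -/
noncomputable def genP (x : ℕ) : PSL(2, ZMod 19) := QuotientGroup.mk (genS x)

theorem genS_prod (t : List ℕ) : ((t.map genS).prod : Matrix (Fin 2) (Fin 2) (ZMod 19)) =
    codeMat 2 19 6860 * (t.map fun q => codeMat 2 19 (codeP q)).prod := by
  rw [codeP_one, one_mul]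
  induction t with
  | nil => rfl
  | cons x t ih =>
    rw [List.map_cons, List.prod_cons, List.map_cons, List.prod_cons,
      Matrix.SpecialLinearGroup.coe_mul, ih]
    rfl

theorem genP_prod (t : List ℕ) : (t.map genP).prod = QuotientGroup.mk (t.map genS).prod := by
  induction t with
  | nil => rfl
  | cons x t ih => rw [List.map_cons, List.prod_cons, List.map_cons, List.prod_cons, ih]; rfl

theorem mem_center_SL {A : SL(2, ZMod 19)} :
    A ∈ Subgroup.center SL(2, ZMod 19) ↔
      (A : Matrix (Fin 2) (Fin 2) (ZMod 19)) = 1 ∨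
      (A : Matrix (Fin 2) (Fin 2) (ZMod 19)) = -1 := by
  rw [Matrix.SpecialLinearGroup.mem_center_iff]
  constructor
  · rintro ⟨r, hr, hA⟩
    have : ∀ r : ZMod 19, r ^ 2 = 1 → r = 1 ∨ r = -1 := by decide
    rcases this r (by simpa using hr) with rfl | rfl
    · exact Or.inl (by rw [← hA, map_one])
    · exact Or.inr (by rw [← hA, map_neg, map_one])
  · rintro (h | h)
    · exact ⟨1, by simp, by rw [h, map_one]⟩
    · exact ⟨-1, by simp, by rw [h, map_neg, map_one]⟩

/-- Check that a word in the elements `genP` is trivial. -/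
def isOneP (t : List ℕ) : Bool :=
  wordEq 2 19 codeP 6860 t 6860 || wordEq 2 19 codeP 6860 t 123480

/-- Check that a word in the elements `genP` is not trivial. -/
def neOneP (t : List ℕ) : Bool :=
  wordNe 2 19 codeP 6860 t 6860 && wordNe 2 19 codeP 6860 t 123480

theorem genP_eq_one {t : List ℕ} (ht : isOneP t = true) : (t.map genP).prod = 1 := by
  rw [genP_prod, QuotientGroup.eq_one_iff, mem_center_SL, genS_prod]
  rw [isOneP, Bool.or_eq_true] at ht
  rcases ht with ht | ht
  · exact Or.inl ((codeMat_wordEq ht).trans codeP_one)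
  · exact Or.inr ((codeMat_wordEq ht).trans codeP_neg_one)

theorem genP_ne_one {t : List ℕ} (ht : neOneP t = true) : (t.map genP).prod ≠ 1 := by
  rw [genP_prod, Ne, QuotientGroup.eq_one_iff, mem_center_SL, genS_prod, ← codeP_neg_one,
    ← codeP_one]
  rw [neOneP, Bool.and_eq_true] at ht
  exact not_or.2 ⟨codeMat_wordNe ht.1, codeMat_wordNe ht.2⟩

/-- The map $(A,u)\mapsto A\,\mathrm{diag}(u,1)$ into $GL_2(19)$ is injective, as the determinant
recovers $u$; and $|GL_2(19)|=360\cdot 342=123120$. -/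
theorem card_SL_le : Nat.card SL(2, ZMod 19) * 18 ≤ 123120 := by
  have : Fact (Nat.Prime 19) := ⟨by norm_num⟩
  let f : SL(2, ZMod 19) × (ZMod 19)ˣ → GL (Fin 2) (ZMod 19) := fun p =>
    (p.1 : GL (Fin 2) (ZMod 19)) * Matrix.GeneralLinearGroup.mkOfDetNeZero
      !![(p.2 : ZMod 19), 0; 0, 1] (by simp [Matrix.det_fin_two])
  have hf : Function.Injective f := by
    rintro ⟨A, u⟩ ⟨B, v⟩ h
    have huv : u = v := by
      have := congrArg (fun X : GL (Fin 2) (ZMod 19) => (X : Matrix (Fin 2) (Fin 2) (ZMod 19)).det) h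
      simpa [f, Matrix.GeneralLinearGroup.mkOfDetNeZero, Matrix.det_fin_two_of, Units.ext_iff] using this
    subst huv
    have := mul_right_cancel h
    rw [Prod.mk.injEq]
    exact ⟨Matrix.SpecialLinearGroup.toGL_injective this, rfl⟩
  have h := Nat.card_le_card_of_injective f hf
  rw [Nat.card_prod, Matrix.card_GL_field, Nat.card_eq_fintype_card (α := (ZMod 19)ˣ),
    ZMod.card_units] at h
  simpa [Fin.prod_univ_two] using h

theorem card_PSL_le : Nat.card PSL(2, ZMod 19) ≤ 3420 := by
  have h := Subgroup.card_eq_card_quotient_mul_card_subgroup (Subgroup.center SL(2, ZMod 19))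
  have h2 : 1 < Nat.card (Subgroup.center SL(2, ZMod 19)) := by
    rw [Finite.one_lt_card_iff_nontrivial]
    refine ⟨⟨1, ⟨-1, mem_center_SL.2 (Or.inr (by simp))⟩, fun h => ?_⟩⟩
    have h1 := congrArg (fun X : Subgroup.center SL(2, ZMod 19) =>
      (X.1 : Matrix (Fin 2) (Fin 2) (ZMod 19)) 0 0) h
    simp at h1
    revert h1
    decide
  have h3 := card_SL_le
  have h4 : Nat.card PSL(2, ZMod 19) * 2 ≤ Nat.card SL(2, ZMod 19) := by
    rw [h]
    exact Nat.mul_le_mul_left _ h2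
  omega

/-- An element of order $p^{n+1}$ in the image. Divisibility is stated for the range because it is
to prove surjectivity. -/
theorem prime_dvd_card_range {φ : W →* PSL(2, ZMod 19)} {f : ℕ → φ.range}
    (hf : ∀ x < 4, (f x : PSL(2, ZMod 19)) = genP x) {p n : ℕ} [Fact p.Prime] {t : List ℕ}
    (ht : ∀ x ∈ t, x < 4)
    (h : (isOneP (rpt (p ^ (n + 1)) t) && neOneP (rpt (p ^ n) t)) = true) :
    p ^ (n + 1) ∣ Nat.card φ.range := by
  have e : ((t.map f).prod : PSL(2, ZMod 19)) = (t.map genP).prod := by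
    rw [← Subgroup.coe_subtype, map_list_prod, List.map_map]
    exact congrArg List.prod (List.map_congr_left fun x hx => hf x (ht x hx))
  rw [Bool.and_eq_true] at h
  have h1 := genP_eq_one h.1
  have h2 := genP_ne_one h.2
  rw [prod_rpt, ← e] at h1 h2
  rw [← orderOf_eq_prime_pow (x := (t.map f).prod) (p := p) (n := n)]
  · exact orderOf_dvd_natCard _
  · exact fun h => h2 (congrArg Subtype.val h)
  · exact Subtype.ext h1

/-- The homomorphism from `W` onto `L₂(19)`. -/
theorem exists_hom_PSL : ∃ φ : W →* PSL(2, ZMod 19), Function.Surjective φ ∧ φ omega = 1 ∧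
    Nat.card PSL(2, ZMod 19) = 3420 := by
  have hr : relWords.all isOneP = true := by decide +kernel
  obtain ⟨φ, hφ⟩ := exists_hom genP (fun w hw => genP_eq_one (List.all_eq_true.1 hr w hw))
  have : Fact (Nat.Prime 5) := ⟨by norm_num⟩
  have : Fact (Nat.Prime 19) := ⟨by norm_num⟩
  obtain ⟨f, hf⟩ : ∃ f : ℕ → φ.range, ∀ x < 4, (f x : PSL(2, ZMod 19)) = genP x :=
    ⟨fun x => if h : x < 4 then ⟨genP x, s ⟨x, h⟩, hφ ⟨x, h⟩⟩ else 1, fun x hx => by simp [hx]⟩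
  -- 3420 = 4 · 9 · 5 · 19, and the image of $s_0s_1s_2s_3$ has order 9.
  have d9 := prime_dvd_card_range hf (p := 3) (n := 1) (t := [0, 1, 2, 3]) (by decide)
    (by decide +kernel)
  have d5 := prime_dvd_card_range hf (p := 5) (n := 0) (t := [0, 1]) (by decide)
    (by decide +kernel)
  have d19 := prime_dvd_card_range hf (p := 19) (n := 0) (t := [3, 0, 2, 1, 3, 0, 2, 1, 2])
    (by decide) (by decide +kernel)
  have d4 : 2 ^ (1 + 1) ∣ Nat.card φ.range := by
    have q : ∀ t : List ℕ, isOneP t = true → (∀ x ∈ t, x < 4) → (t.map f).prod = 1 := by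
      intro t h ht
      apply Subtype.ext
      rw [← Subgroup.coe_subtype, map_list_prod, List.map_map, map_one, ← genP_eq_one h]
      exact congrArg List.prod (List.map_congr_left fun x hx => hf x (ht x hx))
    have qa : f 0 * f 0 = 1 := by simpa using q [0, 0] (by decide +kernel) (by decide)
    have qb : f 2 * f 2 = 1 := by simpa using q [2, 2] (by decide +kernel) (by decide)
    have qab : (f 0 * f 2) ^ 2 = 1 := by
      simpa [pow_two, mul_assoc] using q [0, 2, 0, 2] (by decide +kernel) (by decide)
    have na : f 0 ≠ 1 := fun h => genP_ne_one (t := [0]) (by decide +kernel) (by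
      rw [List.map_singleton, List.prod_singleton, ← hf 0 (by norm_num), h]; rfl)
    have nb : f 2 ≠ 1 := fun h => genP_ne_one (t := [2]) (by decide +kernel) (by
      rw [List.map_singleton, List.prod_singleton, ← hf 2 (by norm_num), h]; rfl)
    have nab : f 0 ≠ f 2 := fun h => genP_ne_one (t := [0, 2]) (by decide +kernel) (by
      have e : f 0 * f 2 = 1 := by rw [← h, qa]
      have := congrArg Subtype.val e
      simpa [← hf 0 (by norm_num), ← hf 2 (by norm_num)] using this)
    have cab := commute_of_sq qa qb qab
    refine two_pow_dvd_card (S := {f 0, f 2}) ?_ ?_ [1, f 0, f 2] ?_ ?_ (by simp)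
    · simp only [Set.mem_insert_iff, Set.mem_singleton_iff]
      rintro x (rfl | rfl) y (rfl | rfl)
      exacts [rfl, cab, cab.symm, rfl]
    · simp only [Set.mem_insert_iff, Set.mem_singleton_iff]
      rintro x (rfl | rfl) <;> assumption
    · simp [na.symm, nb.symm, nab]
    · simp only [List.mem_cons, List.not_mem_nil, or_false]
      rintro x (rfl | rfl | rfl)
      exacts [one_mem _, Subgroup.subset_closure (by simp), Subgroup.subset_closure (by simp)]
  have h : Nat.Coprime 4 9 ∧ Nat.Coprime (4 * 9) 5 ∧ Nat.Coprime (4 * 9 * 5) 19 := by norm_num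
  obtain ⟨h1, h2, h3⟩ := h
  have d := h3.mul_dvd_of_dvd_of_dvd (h2.mul_dvd_of_dvd_of_dvd
    (h1.mul_dvd_of_dvd_of_dvd d4 d9) d5) d19
  -- The range has at least as many elements as the upper bound for the whole group, so it is
  -- everything.
  have hle : 3420 ≤ Nat.card φ.range := Nat.le_of_dvd Nat.card_pos d
  have htop : φ.range = ⊤ :=
    Subgroup.eq_top_of_le_card _ (card_PSL_le.trans hle)
  refine ⟨φ, MonoidHom.range_eq_top.1 htop, ?_, ?_⟩
  · have h1 := genP_eq_one (t := wordOmega) (by decide +kernel)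
    have e0 := hφ 0
    have e1 := hφ 1
    have e2 := hφ 2
    rw [wordOmega, prod_rpt] at h1
    simp only [omega, map_pow, map_mul, e0, e1, e2]
    simpa [mul_assoc] using h1
  · rw [htop, Subgroup.card_top] at hle
    exact le_antisymm card_PSL_le hle

/-! ### The upper bound for the order of `W` -/

/-- The generators of `W`, indexed by natural numbers. -/
def genW (x : ℕ) : W := if h : x < 4 then s ⟨x, h⟩ else 1

theorem genW_of_le : ∀ i, 4 ≤ i → genW i = 1 := fun i hi => dif_neg (by omega)

theorem letter_genW : letter genW 0 = s 0 ∧ letter genW 2 = s 1 ∧ letter genW 4 = s 2 ∧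
    letter genW 6 = s 3 := ⟨rfl, rfl, rfl, rfl⟩

theorem rels_genW : ∀ w ∈ certL.rels, ev genW w = 1 := by
  obtain ⟨e0, e1, e2, e3⟩ := letter_genW
  have h0 := s_sq 0
  have h1 := s_sq 1
  have h2 := s_sq 2
  have h3 := s_sq 3
  have h4 := s01
  have h5 := s12
  have h6 := s23
  have h7 := s123
  have sq : ∀ a b : W, a * a = 1 → b * b = 1 → a * b = b * a → a * (b * (a * b)) = 1 := by
    intro a b ha hb hab
    rw [hab, ← mul_assoc b b, hb, one_mul, ha]
  simp only [pow_succ, pow_zero, one_mul, mul_assoc] at h4 h5 h6 h7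
  simp only [certL, List.forall_mem_cons, ev_cons, ev_nil, mul_one, e0, e1, e2, e3]
  exact ⟨h0, h1, h2, h3, h4, h5, h6, sq _ _ h0 h2 s02, sq _ _ h1 h3 s13, sq _ _ h0 h3 s03, h7,
    by simp⟩

theorem closure_genW : Subgroup.closure (Set.range genW) = ⊤ := by
  rw [← top_le_iff, ← closure_s, Subgroup.closure_le]
  rintro _ ⟨i, rfl⟩
  exact Subgroup.subset_closure ⟨i, by simp [genW]⟩

/-- Only this inclusion is needed: it turns the cover by 20 cosets into $|W|\le 20|L|$. -/
theorem closure_subGens_le : Subgroup.closure (Set.range (subGens certL genW)) ≤ L := by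
  have h3 := label_three genW_of_le rels_genW
  have h4 := label_four genW_of_le rels_genW
  obtain ⟨e0, e1, e2, e3⟩ := letter_genW
  have ha : subGens certL genW 0 ∈ L := by
    have : subGens certL genW 0 = s 2 * s 1 := by
      have hr : rep certL genW 1 = s 2 := by
        have hp : certL.par 1 = 4 := by decide +kernel
        simp [rep, hp, e2]
      have hr0 : rep certL genW 0 = 1 := by simp [rep]
      change rep certL genW 1 * letter genW 2 * (rep certL genW 0)⁻¹ = _
      rw [hr, hr0, e1, inv_one, mul_one]
    rw [this]
    exact Subgroup.subset_closure (by simp)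
  have hb : ev genW [0, 2, 0, 2, 4, 6, 0] ∈ L := by
    refine Subgroup.subset_closure (Or.inr (Or.inl ?_))
    simp [e0, e1, e2, e3, pow_two, mul_assoc]
  have hc : ev genW [0, 2, 0, 6, 4, 6, 2] ∈ L := by
    refine Subgroup.subset_closure (Or.inr (Or.inr ?_))
    simp [e0, e1, e2, e3, mul_assoc]
  -- With $x,y$ the two generators, the labels read $b=yxy^{-2}$ and $c=yxy^{-1}x$, whence
  -- $b^{-1}cx^{-1}=y$.
  have hq : subGens certL genW 1 = (ev genW [0, 2, 0, 2, 4, 6, 0])⁻¹ *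
      ev genW [0, 2, 0, 6, 4, 6, 2] * (subGens certL genW 0)⁻¹ := by
    rw [h3, h4]
    simp [letter, mul_assoc]
  rw [Subgroup.closure_le]
  rintro _ ⟨i, rfl⟩
  rcases lt_or_ge i 2 with hi | hi
  · interval_cases i
    · exact ha
    · rw [hq]
      exact mul_mem (mul_mem (inv_mem hb) hc) (inv_mem ha)
  · rw [subGens_of_le certL genW rfl i hi]
    exact one_mem _

theorem finite_W : Finite W ∧ Nat.card W ≤ 175560 * 3420 ∧ Nat.card W ≤ 20 * Nat.card L := by
  have hf := finite_closure_subGens genW_of_le rels_genW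
  obtain ⟨l, hl, hcov⟩ := (check_subGens certL_check genW_of_le rels_genW).2 (by norm_num)
  rw [closure_genW] at hcov
  have h := finite_of_cover _ l hl hcov hf
  have hfin : Finite W := Set.finite_univ_iff.1 (by simpa using h.1)
  have hcard : ∀ n, ((⊤ : Subgroup W) : Set W).ncard ≤ n → Nat.card W ≤ n := by
    intro n hn
    rwa [Subgroup.coe_top, Set.ncard_univ] at hn
  refine ⟨hfin, (hcard _ h.2).trans (by norm_num), ?_⟩
  -- The same cover, now with the exact size of the subgroup in place of the numerical bound.
  have h' := finite_of_cover _ l hl hcov ⟨hf.1, le_rfl⟩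
  refine (hcard _ h'.2).trans (Nat.mul_le_mul_left _ ?_)
  exact Subgroup.card_le_of_le closure_subGens_le

/-! ### An action on twenty points and the index of `L` -/

/-- Images of the points `0, …, 19` under the generators of `W`. -/
def tableL : List (List ℕ) :=
  [[2, 10, 0, 4, 3, 14, 9, 12, 16, 6, 1, 13, 7, 11, 5, 18, 8, 19, 15, 17],
   [1, 0, 3, 2, 5, 4, 12, 15, 9, 8, 17, 18, 6, 16, 19, 7, 13, 10, 11, 14],
   [1, 0, 10, 11, 13, 6, 5, 8, 7, 14, 2, 3, 16, 4, 9, 19, 12, 18, 17, 15],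
   [9, 8, 6, 12, 7, 15, 2, 4, 1, 0, 16, 19, 3, 17, 18, 5, 10, 13, 14, 11]]

/-- The action of a generator of `W` on twenty points. -/
def mapL (x : ℕ) (i : Fin 20) : Fin 20 := Fin.ofNat 20 ((tableL.getD x []).getD i i)

theorem mapL_mapL (x : ℕ) (i : Fin 20) : mapL x (mapL x i) = i := by
  rcases lt_or_ge x 4 with h | h
  · have : ∀ x < 4, ∀ i : Fin 20, mapL x (mapL x i) = i := by decide +kernel
    exact this x h i
  · have : ∀ i, mapL x i = i := fun i => by
      unfold mapL
      rw [List.getD_eq_default tableL _ (by simpa [tableL] using h)]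
      simp
    rw [this, this]

/-- The permutation of twenty points given by a generator of `W`. -/
def permL (x : ℕ) : Equiv.Perm (Fin 20) := ⟨mapL x, mapL x, mapL_mapL x, mapL_mapL x⟩

/-- Words that take the point `0` to each of the twenty points. -/
def wordsOrbit : List (List (Fin 4)) :=
  [[], [1], [0], [1, 0], [0, 1, 0], [2, 3, 0], [3, 0], [2, 3, 1], [3, 1], [3], [2, 0], [2, 1, 0],
    [3, 1, 0], [2, 0, 1, 0], [2, 3], [3, 2, 3, 0], [3, 2, 0], [1, 2, 0], [3, 2, 3], [1, 2, 3]]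

/-- The action is transitive and `L` fixes the point 0, so the index 20 of the stabilizer divides
that of `L`. -/
theorem twenty_le_index_L [Finite W] : 20 ≤ L.index := by
  obtain ⟨ψ, hψ⟩ := exists_hom permL (by
    have : ∀ w ∈ relWords, ∀ i, (w.map permL).prod i = i := by decide +kernel
    exact fun w hw => Equiv.ext (this w hw))
  let _ : MulAction W (Fin 20) := MulAction.compHom (Fin 20) ψ
  have hs : ∀ (i : Fin 4) (a : Fin 20), s i • a = permL i a := fun i a => by
    rw [← hψ]; rfl
  have hfix : L ≤ MulAction.stabilizer W (0 : Fin 20) := by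
    refine (Subgroup.closure_le _).2 ?_
    have : permL 2 (permL 1 0) = 0 ∧
      permL 0 (permL 1 (permL 0 (permL 1 (permL 2 (permL 3 (permL 0 0)))))) = 0 ∧
      permL 0 (permL 1 (permL 0 (permL 3 (permL 2 (permL 3 (permL 1 0)))))) = 0 := by
      decide +kernel
    rintro x (rfl | rfl | rfl) <;>
      simp only [SetLike.mem_coe, MulAction.mem_stabilizer_iff, pow_two, mul_smul, hs]
    exacts [this.1, this.2.1, this.2.2]
  have horb : MulAction.orbit W (0 : Fin 20) = Set.univ := by
    have hstep : ∀ (i : Fin 4) a, a ∈ MulAction.orbit W (0 : Fin 20) →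
        permL i a ∈ MulAction.orbit W (0 : Fin 20) := by
      rintro i _ ⟨g, rfl⟩
      exact ⟨s i * g, by simp only [mul_smul, hs]⟩
    have hw : ∀ t : List (Fin 4), t.foldr (fun i a => permL i a) 0 ∈
        MulAction.orbit W (0 : Fin 20) := by
      intro t
      induction t with
      | nil => exact MulAction.mem_orbit_self _
      | cons i t ih => exact hstep i _ ih
    have hall : ∀ a : Fin 20, ∃ t ∈ wordsOrbit, t.foldr (fun i a => permL i a) 0 = a := by
      decide +kernel
    refine Set.eq_univ_of_forall fun a => ?_
    obtain ⟨t, -, rfl⟩ := hall a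
    exact hw _
  have hidx : (MulAction.stabilizer W (0 : Fin 20)).index = 20 := by
    rw [MulAction.index_stabilizer, horb, Set.ncard_univ, Nat.card_fin]
  rw [← hidx]
  exact Nat.le_of_dvd (Nat.pos_of_ne_zero Subgroup.index_ne_zero_of_finite)
    (Subgroup.index_dvd_of_le hfix)

/-- Modulo both subgroups $\omega=1$, so $\nu=s_3$, and $s_3^2=s_3^3=1$ kills $s_3$. The odd
exponents in $(s_2s_3)^5$, $(s_1s_2)^3$ and $(s_0s_1)^5$ then kill the involutions $s_2$, $s_1$,
$s_0$ in turn. -/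
theorem sup_eq_top : N' ⊔ N'' = ⊤ := by
  rw [← top_le_iff, ← closure_s, Subgroup.closure_le]
  let π := QuotientGroup.mk' (N' ⊔ N'')
  have key : ∀ x, x ∈ N' ⊔ N'' ↔ π x = 1 := fun x => (QuotientGroup.eq_one_iff x).symm
  have hω : π omega = 1 := (key _).1
    (le_sup_right (a := N') (Subgroup.subset_normalClosure rfl))
  have hν : π (nu ^ 3) = 1 := (key _).1
    (le_sup_left (b := N'') (Subgroup.subset_normalClosure rfl))
  have m : ∀ i, π (s i) * π (s i) = 1 := fun i => by rw [← map_mul, s_sq, map_one]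
  have m3 : π (s 3) = 1 := by
    rw [nu, map_pow, map_mul, hω, one_mul, pow_succ, pow_two, m, one_mul] at hν
    exact hν
  have odd5 : ∀ i j, (s i * s j) ^ 5 = 1 → π (s j) = 1 → π (s i) = 1 := by
    intro i j h hj
    have := congrArg π h
    rw [map_pow, map_mul, hj, mul_one, map_one] at this
    rwa [pow_succ, show π (s i) ^ 4 = 1 from (pow_mul (π (s i)) 2 2).trans (by
      rw [pow_two (π (s i)), m, one_pow]), one_mul] at this
  have m2 : π (s 2) = 1 := odd5 2 3 s23 m3
  have m1 : π (s 1) = 1 := by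
    have := congrArg π s12
    rwa [map_pow, map_mul, m2, mul_one, map_one, pow_succ, pow_two, m, one_mul] at this
  have m0 : π (s 0) = 1 := odd5 0 1 s01 m1
  rintro _ ⟨i, rfl⟩
  refine (key _).2 ?_
  fin_cases i
  exacts [m0, m1, m2, m3]

end Polytope535

/-! ### The direct product decomposition -/

open Polytope535 in
theorem mainTheorem2 :
    Finite Polytope535.W ∧
    Nat.card Polytope535.W = 175560 * 3420 ∧
    Nonempty (Polytope535.W ≃* Polytope535.J1 × PSL(2, ZMod 19)) ∧
    Polytope535.L.index = 20 ∧
    Nat.card Polytope535.L = 30020760 ∧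
    Nonempty (Polytope535.W ⧸ Polytope535.N' ≃* Polytope535.J1) ∧
    Nonempty (Polytope535.W ⧸ Polytope535.N'' ≃* PSL(2, ZMod 19)) ∧
    ∃ e : Polytope535.N' × Polytope535.N'' ≃* Polytope535.W,
      ∀ (a : Polytope535.N') (b : Polytope535.N''),
        e (a, b) = (a : Polytope535.W) * (b : Polytope535.W) := by
  obtain ⟨hfin, hle, hleL⟩ := finite_W
  obtain ⟨φ₁, hs1, hν⟩ := exists_hom_J1
  obtain ⟨φ₂, hs2, hω, hcard2⟩ := exists_hom_PSL
  have hk1 : N' ≤ φ₁.ker := Subgroup.normalClosure_le_normal (by simpa using hν)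
  have hk2 : N'' ≤ φ₂.ker := Subgroup.normalClosure_le_normal (by simpa using hω)
  have hsup := sup_eq_top
  have hdec : ∀ x : W, ∃ a ∈ N', ∃ b ∈ N'', a * b = x := fun x =>
    Subgroup.mem_sup_of_normal_right.1 (hsup ▸ Subgroup.mem_top x)
  let Φ : W →* J1 × PSL(2, ZMod 19) := φ₁.prod φ₂
  have hΦ : Function.Surjective Φ := by
    rintro ⟨y, z⟩
    obtain ⟨u, rfl⟩ := hs1 y
    obtain ⟨v, rfl⟩ := hs2 z
    obtain ⟨a, ha, b, hb, rfl⟩ := hdec u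
    obtain ⟨c, hc, d, hd, rfl⟩ := hdec v
    have ha := hk1 ha
    have hb := hk2 hb
    have hc := hk1 hc
    have hd := hk2 hd
    rw [MonoidHom.mem_ker] at ha hb hc hd
    -- With u = ab and v = cd, the first map sees only b and the second only c.
    exact ⟨c * b, by simp [Φ, ha, hb, hc, hd]⟩
  have : Finite J1 := Finite.of_surjective _ hs1
  have hle1 : 175560 ≤ Nat.card J1 := Nat.le_of_dvd Nat.card_pos dvd_card_J1
  have hcardΦ : Nat.card (J1 × PSL(2, ZMod 19)) ≤ Nat.card W := Nat.card_le_card_of_surjective _ hΦ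
  have hge : 175560 * 3420 ≤ Nat.card (J1 × PSL(2, ZMod 19)) := by
    rw [Nat.card_prod, hcard2]
    exact Nat.mul_le_mul_right _ hle1
  -- The lower bound through the surjection meets the upper bound from the enumerations.
  have hW : Nat.card W = 175560 * 3420 := le_antisymm hle (hge.trans hcardΦ)
  have hbij : Function.Bijective Φ :=
    (Nat.bijective_iff_surjective_and_card Φ).2 ⟨hΦ, le_antisymm (hle.trans hge) hcardΦ⟩
  have hone : ∀ x, φ₁ x = 1 → φ₂ x = 1 → x = 1 := fun x h1 h2 =>
    hbij.1 (by simp [Φ, h1, h2])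
  -- Write an element of the kernel as ab with a in `N'` and b in `N''`; both maps kill b, so b = 1
  -- by injectivity of `Φ`.
  have hker1 : φ₁.ker = N' := by
    refine le_antisymm (fun x hx => ?_) hk1
    obtain ⟨a, ha, b, hb, rfl⟩ := hdec x
    have h1 : φ₁ b = 1 := by
      have ha' := MonoidHom.mem_ker.1 (hk1 ha)
      rwa [MonoidHom.mem_ker, map_mul, ha', one_mul] at hx
    rwa [hone b h1 (MonoidHom.mem_ker.1 (hk2 hb)), mul_one]
  have hker2 : φ₂.ker = N'' := by
    refine le_antisymm (fun x hx => ?_) hk2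
    obtain ⟨a, ha, b, hb, rfl⟩ := hdec x
    have h2 : φ₂ a = 1 := by
      have hb' := MonoidHom.mem_ker.1 (hk2 hb)
      rwa [MonoidHom.mem_ker, map_mul, hb', mul_one] at hx
    rwa [hone a (MonoidHom.mem_ker.1 (hk1 ha)) h2, one_mul]
  have hmul := L.card_mul_index
  have hidx := twenty_le_index_L
  have hidx' : L.index = 20 := by
    refine le_antisymm ?_ hidx
    have : Nat.card L * L.index ≤ Nat.card L * 20 := by rw [hmul, mul_comm]; exact hleL
    exact Nat.le_of_mul_le_mul_left this Nat.card_pos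
  refine ⟨hfin, hW, ⟨MulEquiv.ofBijective Φ hbij⟩, hidx', ?_, ?_, ?_, ?_⟩
  · rw [hidx', hW] at hmul
    omega
  · exact ⟨(QuotientGroup.quotientMulEquivOfEq hker1.symm).trans
      (QuotientGroup.quotientKerEquivOfSurjective φ₁ hs1)⟩
  · exact ⟨(QuotientGroup.quotientMulEquivOfEq hker2.symm).trans
      (QuotientGroup.quotientKerEquivOfSurjective φ₂ hs2)⟩
  · have hdisj : Disjoint N' N'' := by
      rw [Subgroup.disjoint_def]
      exact fun h1 h2 => hone _ (hk1 h1) (hk2 h2)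
    let F : N' × N'' →* W := MonoidHom.noncommCoprod N'.subtype N''.subtype fun a b =>
      Subgroup.commute_of_normal_of_disjoint _ _ inferInstance inferInstance hdisj _ _ a.2 b.2
    have hF : Function.Bijective F := by
      refine ⟨(injective_iff_map_eq_one F).2 ?_, fun x => ?_⟩
      · rintro ⟨a, b⟩ h
        have h : (a : W) * b = 1 := h
        have ha : (a : W) = 1 := by
          refine hone _ (hk1 a.2) ?_
          have hb : φ₂ b = 1 := hk2 b.2
          have := congrArg φ₂ h
          rwa [map_mul, hb, mul_one, map_one] at this
        rw [ha, one_mul] at h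
        exact Prod.ext (Subtype.ext ha) (Subtype.ext h)
      · obtain ⟨a, ha, b, hb, rfl⟩ := hdec x
        exact ⟨(⟨a, ha⟩, ⟨b, hb⟩), rfl⟩
    exact ⟨MulEquiv.ofBijective F hF, fun a b => rfl⟩
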